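/- Let $H$ be a separable real Hilbert space and let $\mathcal P_2(H)$ be the set of Borel probability measures on $H$ with finite second moment, equipped with the Wasserstein distance $\mathcal W_2$, where $\mathcal W_2^2(\mu,\nu)=\inf_{\pi\in\mathrm{Cpl}(\mu,\nu)}\int\|x-y\|^2\,d\pi$ and $\mathrm{Cpl}(\mu,\nu)$ is the set of couplings of $\mu$ and $\nu$. For $\pi\in\mathrm{Cpl}(\mu,\nu)$ and $t\in[0,1]$ write $\pi_t:=((x,y)\mapsto(1-t)x+ty)_\#\pi\in\mathcal P_2(H)$. Let $(\Omega,\mathcal F,\mathbb P)$ be a standard probability space, i.e. isomorphic (up to null sets) to $[0,1]$ with Lebesgue measure. Let $\varphi:\mathcal P_2(H)\to(-\infty,+\infty]$ be lower semicontinuous with respect to $\mathcal W_2$ (in particular, $\varphi$ may be any proper lower semicontinuous functional), and let $\operatorname{dom}\varphi=\{\mu:\varphi(\mu)<\infty\}$. Then the following are equivalent: 1. $\varphi$ is totally convex: $\varphi(\pi_t)\le(1-t)\varphi(\mu)+t\varphi(\nu)$ for all $\mu,\nu\in\mathcal P_2(H)$, all $\pi\in\mathrm{Cpl}(\mu,\nu)$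 and all $t\in[0,1]$ (with $0\cdot\infty=0$). 2. The Lions lift $\overline\varphi:L_2(\Omega,\mathcal F,\mathbb P;H)\to(-\infty,+\infty]$, $\overline\varphi(X):=\varphi(\mathrm{Law}(X))$, is convex. 3. $\varphi$ is MC-convex: $\varphi^{\mathrm{MC}\,\mathrm{MC}}=\varphi$, where $\psi^{\mathrm{MC}}(\nu):=\sup_{\mu\in\mathcal P_2(H)}\bigl(\mathrm{MC}(\mu,\nu)-\psi(\mu)\bigr)$ for $\psi:\mathcal P_2(H)\to[-\infty,+\infty]$ and $\mathrm{MC}(\mu,\nu):=\sup_{\pi\in\mathrm{Cpl}(\mu,\nu)}\int\langle x,y\rangle\,d\pi(x,y)$. 4. The following three properties hold: (a) $\operatorname{dom}\varphi$ is totally convex, i.e. $\pi_t\in\operatorname{dom}\varphi$ for all $\mu,\nu\in\operatorname{dom}\varphi$, $\pi\in\mathrm{Cpl}(\mu,\nu)$ and $t\in[0,1]$; (b) $\varphi$ is displacement convex, i.e. the inequality in 1 holds for all $\mu,\nu$, all $t\in[0,1]$ and all couplings $\pi\in\mathrm{Cpl}(\mu,\nu)$ that are optimal for the cost $\|x-y\|^2$;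 (c) $\varphi$ is increasing in convex order, i.e. $\varphi(\mu)\le\varphi(\nu)$ whenever $\int f\,d\mu\le\int f\,d\nu$ for every continuous convex $f:H\to\mathbb R$ that is integrable with respect to both $\mu$ and $\nu$. -/

import Mathlib

open MeasureTheory

noncomputable section

namespace WassersteinConvexity

section Space

variable {H : Type*} [NormedAddCommGroup H] [InnerProductSpace ℝ H] [CompleteSpace H]
  [SecondCountableTopology H] [MeasurableSpace H] [BorelSpace H]

variable (H) in
/-- The Wasserstein space `𝒫₂(H)`: Borel probability measures on `H` with finite second moment. -/
def P2 : Type _ := {μ : Measure H // IsProbabilityMeasure μ ∧ MemLp (fun x : H => x) 2 μ}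

/-- The law of a square-integrable `H`-valued random variable, as an element of `𝒫₂(H)`. -/
def law {Ω : Type*} [MeasurableSpace Ω] (P : Measure Ω) [IsProbabilityMeasure P]
    (X : Ω → H) (hX : MemLp X 2 P) : P2 H :=
  ⟨P.map X, Measure.isProbabilityMeasure_map hX.1.aemeasurable,
    (memLp_map_measure_iff aestronglyMeasurable_id hX.1.aemeasurable).2 hX⟩

/-- `π ∈ Cpl(μ, ν)`: the measure `π` on `H × H` has marginals `μ` and `ν`. -/
def IsCoupling (π : Measure (H × H)) (μ ν : P2 H) : Prop :=
  π.map Prod.fst = μ.1 ∧ π.map Prod.snd = ν.1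

/-- The quadratic transport cost `∫ ‖x - y‖² dπ(x, y)`. -/
def cost (π : Measure (H × H)) : ENNReal := ∫⁻ z, ‖z.1 - z.2‖ₑ ^ 2 ∂π

/-- The Wasserstein distance: `𝒲₂²(μ, ν)` is the infimum of the cost over all couplings. -/
def W2 (μ ν : P2 H) : ENNReal := (⨅ (π : Measure (H × H)) (_ : IsCoupling π μ ν), cost π) ^ (1 / 2 : ℝ)

/-- `π` is an optimal coupling of `μ` and `ν` for the squared distance cost. -/
def IsOptimalCoupling (π : Measure (H × H)) (μ ν : P2 H) : Prop :=
  IsCoupling π μ ν ∧ ∀ π' : Measure (H × H), IsCoupling π' μ ν → cost π ≤ cost π'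

/-- Lower semicontinuity on `𝒫₂(H)` with respect to the distance `𝒲₂`. -/
def IsLsc (φ : P2 H → EReal) : Prop :=
  ∀ μ : P2 H, ∀ y : EReal, y < φ μ → ∃ ε : ENNReal, 0 < ε ∧ ∀ ν : P2 H, W2 μ ν < ε → y < φ ν

theorem IsCoupling.isProbabilityMeasure {π : Measure (H × H)} {μ ν : P2 H}
    (h : IsCoupling π μ ν) : IsProbabilityMeasure π := by
  have : IsProbabilityMeasure (π.map Prod.fst) := h.1 ▸ μ.2.1
  exact Measure.isProbabilityMeasure_of_map (μ := π) Prod.fst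

/-- The map `(x, y) ↦ (1 - t) x + t y`. -/
def interpMap (t : ℝ) (z : H × H) : H := (1 - t) • z.1 + t • z.2

theorem IsCoupling.memLp_interpMap {π : Measure (H × H)} {μ ν : P2 H}
    (h : IsCoupling π μ ν) (t : ℝ) : MemLp (interpMap (H := H) t) 2 π := by
  have h1 : MemLp (fun z : H × H => z.1) 2 π :=
    (memLp_map_measure_iff aestronglyMeasurable_id measurable_fst.aemeasurable).1
      (h.1.symm ▸ μ.2.2)
  have h2 : MemLp (fun z : H × H => z.2) 2 π :=
    (memLp_map_measure_iff aestronglyMeasurable_id measurable_snd.aemeasurable).1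
      (h.2.symm ▸ ν.2.2)
  exact (h1.const_smul (1 - t)).add (h2.const_smul t)

/-- The interpolation `μ_t = ((x, y) ↦ (1 - t) x + t y)_# π` along a coupling `π`. -/
def IsCoupling.interp {π : Measure (H × H)} {μ ν : P2 H} (h : IsCoupling π μ ν) (t : ℝ) : P2 H :=
  haveI := h.isProbabilityMeasure
  law π (interpMap t) (h.memLp_interpMap t)

/-- Total convexity of a functional: convexity along the interpolation of every coupling. -/
def TotallyConvex (φ : P2 H → EReal) : Prop :=
  ∀ (μ ν : P2 H) (π : Measure (H × H)) (h : IsCoupling π μ ν), ∀ t ∈ Set.Icc (0 : ℝ) 1,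
    φ (h.interp t) ≤ ((1 - t : ℝ) : EReal) * φ μ + (t : EReal) * φ ν

/-- Displacement convexity: convexity along the interpolation of every optimal coupling, that is,
along every `𝒲₂`-geodesic. -/
def DisplacementConvex (φ : P2 H → EReal) : Prop :=
  ∀ (μ ν : P2 H) (π : Measure (H × H)) (h : IsOptimalCoupling π μ ν), ∀ t ∈ Set.Icc (0 : ℝ) 1,
    φ (h.1.interp t) ≤ ((1 - t : ℝ) : EReal) * φ μ + (t : EReal) * φ ν

/-- Total convexity of a subset of `𝒫₂(H)`. -/
def TotallyConvexSet (A : Set (P2 H)) : Prop :=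
  ∀ μ ∈ A, ∀ ν ∈ A, ∀ (π : Measure (H × H)) (h : IsCoupling π μ ν), ∀ t ∈ Set.Icc (0 : ℝ) 1,
    h.interp t ∈ A

/-- The domain of `φ`: the set of points at which `φ` is finite. -/
def dom (φ : P2 H → EReal) : Set (P2 H) := {μ | φ μ ≠ ⊥ ∧ φ μ ≠ ⊤}

/-- The convex order: `∫ f dμ ≤ ∫ f dν` for all convex `f`. The integrals of a continuous convex
`f` always exist in `(-∞, ∞]`; since such an `f` is an increasing limit of Lipschitz convex
functions, it is enough to test with those `f` for which both integrals are finite. -/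
def ConvexOrder (μ ν : P2 H) : Prop :=
  ∀ f : H → ℝ, ConvexOn ℝ Set.univ f → Continuous f → Integrable f μ.1 → Integrable f ν.1 →
    ∫ x, f x ∂μ.1 ≤ ∫ x, f x ∂ν.1

/-- `φ` is increasing in convex order. -/
def IncreasingInConvexOrder (φ : P2 H → EReal) : Prop :=
  ∀ μ ν : P2 H, ConvexOrder μ ν → φ μ ≤ φ ν

/-- The maximal covariance `MC(μ, ν)`, the supremum of `∫ ⟨x, y⟩ dπ(x, y)` over all couplings
(the integrand is integrable for every coupling, and `MC(μ, ν)` is always finite). -/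
def MC (μ ν : P2 H) : EReal :=
  ⨆ (π : Measure (H × H)) (_ : IsCoupling π μ ν), ((∫ z, inner ℝ z.1 z.2 ∂π : ℝ) : EReal)

/-- The MC-conjugate `φ^MC(ν) = sup_μ (MC(μ, ν) - φ(μ))`. -/
def mcConj (φ : P2 H → EReal) (ν : P2 H) : EReal := ⨆ μ : P2 H, MC μ ν - φ μ

/-- `φ` is MC-convex: it equals its MC-biconjugate. -/
def MCConvex (φ : P2 H → EReal) : Prop := mcConj (mcConj φ) = φ

/-- A standard probability space: isomorphic (up to null sets) to the unit interval with Lebesgue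
measure. -/
def IsStandardProbabilitySpace {Ω : Type*} [MeasurableSpace Ω] (P : Measure Ω) : Prop :=
  ∃ (f : Ω → unitInterval) (g : unitInterval → Ω),
    MeasurePreserving f P volume ∧ MeasurePreserving g volume P ∧
      (∀ᵐ ω ∂P, g (f ω) = ω) ∧ ∀ᵐ u ∂(volume : Measure unitInterval), f (g u) = u

/-- The Lions lift `X ↦ φ(Law(X))` of `φ` to `L₂(Ω, P; H)`. -/
def lionsLift {Ω : Type*} [MeasurableSpace Ω] (P : Measure Ω) [IsProbabilityMeasure P]
    (φ : P2 H → EReal) (X : Lp H 2 P) : EReal :=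
  φ (law P X (Lp.memLp X))

end Space

/-- Convexity of a function with values in the extended reals (which never takes the value `-∞`
where this is used). -/
def ConvexFun {E : Type*} [AddCommGroup E] [Module ℝ E] (f : E → EReal) : Prop :=
  ∀ x y : E, ∀ t ∈ Set.Icc (0 : ℝ) 1,
    f ((1 - t) • x + t • y) ≤ ((1 - t : ℝ) : EReal) * f x + (t : EReal) * f y

end WassersteinConvexity

end

/-! Total convexity is the hub of the equivalence. Every coupling is the joint law of two variables
on a standard space, so total convexity amounts to convexity of the Lions lift.

From MC-convexity to total convexity: `φ` is a supremum of functionals `MC(·, ρ) - const`, and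
`MC(·, ρ)` is totally convex (`MC_interp_le`), since a coupling of `π_t` with `ρ` can be glued to
`π` and the inner product is bilinear.

Conversely, Fenchel-Moreau in `L²(μ)` gives an affine minorant `⟨Z, ·⟩ + c` of the lift that is
nearly sharp at the identity. To bound `φ^MC(Law Z)` by `-c`, the minorant must also be tested
against variables `G` on an extension of the space. Conditional expectation reduces this to the
original space: it keeps `E⟨Z, G⟩` and does not increase `φ` (`TotallyConvex.law_integral_le`). The
latter Jensen inequality holds because averaging two conditionally independent copies halves the
conditional variance without increasing `φ`; iterate and use lower semicontinuity.

Monotonicity in convex order follows from MC-convexity once `MC(·, ρ)` is known to be increasing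
(`MC_le_of_convexOrder`). After discretization, duality for the assignment problem supplies a
maximum of affine functions as the convex test function.

From (a), (b), (c) to total convexity: move finitely many equal particles along straight lines.
Short segments issued from a given time are optimal, so (b) applies to them. Across a collision time
the optimal coupling may exchange only the colliding particles, which enlarges the midpoint in
convex order, so (c) yields local midpoint convexity. Together these put the function below its
chord (`le_chord_of_local`). General couplings are approximated by cell averages, which decrease `φ`
by (c), and lower semicontinuity concludes. -/

set_option linter.unusedSectionVars false

noncomputable section

namespace WassersteinConvexity

section Basic

variable {H : Type*} [NormedAddCommGroup H] [InnerProductSpace ℝ H] [CompleteSpace H]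
  [SecondCountableTopology H] [MeasurableSpace H] [BorelSpace H]
variable {S : Type*} [MeasurableSpace S] {P : Measure S} [IsProbabilityMeasure P]

/-! ### Laws of random variables -/

theorem law_eq_of_map_eq {T : Type*} [MeasurableSpace T] {Q : Measure T} [IsProbabilityMeasure Q]
    {X : S → H} {Y : T → H} (hX : MemLp X 2 P) (hY : MemLp Y 2 Q) (h : P.map X = Q.map Y) :
    law P X hX = law Q Y hY :=
  Subtype.ext h

theorem law_congr {X Y : S → H} (hX : MemLp X 2 P) (hY : MemLp Y 2 P) (h : X =ᵐ[P] Y) :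
    law P X hX = law P Y hY :=
  law_eq_of_map_eq hX hY (Measure.map_congr h)

theorem law_id (μ : P2 H) :
    haveI := μ.2.1
    law μ.1 (fun x => x) μ.2.2 = μ :=
  Subtype.ext Measure.map_id

theorem law_comp {T : Type*} [MeasurableSpace T] {Q : Measure T} [IsProbabilityMeasure Q]
    {f : T → S} (hf : MeasurePreserving f Q P) {X : S → H} (hX : MemLp X 2 P) :
    law Q (X ∘ f) (hX.comp_measurePreserving hf) = law P X hX := by
  refine Subtype.ext ?_
  change Q.map (X ∘ f) = P.map X
  rw [← AEMeasurable.map_map_of_aemeasurable (by rw [hf.map_eq]; exact hX.1.aemeasurable)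
    hf.measurable.aemeasurable, hf.map_eq]

theorem isCoupling_map {X Y : S → H} (hX : MemLp X 2 P) (hY : MemLp Y 2 P) :
    IsCoupling (P.map fun s => (X s, Y s)) (law P X hX) (law P Y hY) := by
  have h := hX.1.aemeasurable.prodMk hY.1.aemeasurable
  constructor
  · rw [AEMeasurable.map_map_of_aemeasurable measurable_fst.aemeasurable h]; rfl
  · rw [AEMeasurable.map_map_of_aemeasurable measurable_snd.aemeasurable h]; rfl

theorem measurable_interpMap (t : ℝ) : Measurable (interpMap (H := H) t) := by
  unfold interpMap; fun_prop

theorem memLp_interp {X Y : S → H} (hX : MemLp X 2 P) (hY : MemLp Y 2 P) (t : ℝ) :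
    MemLp (fun s => (1 - t) • X s + t • Y s) 2 P :=
  (hX.const_smul (1 - t)).add (hY.const_smul t)

theorem interp_map {X Y : S → H} (hX : MemLp X 2 P) (hY : MemLp Y 2 P) (t : ℝ) :
    (isCoupling_map hX hY).interp t = law P _ (memLp_interp hX hY t) := by
  refine Subtype.ext ?_
  change (P.map fun s => (X s, Y s)).map (interpMap t) = P.map _
  rw [AEMeasurable.map_map_of_aemeasurable (measurable_interpMap t).aemeasurable
    (hX.1.aemeasurable.prodMk hY.1.aemeasurable)]
  rfl

theorem IsCoupling.memLp_fst {π : Measure (H × H)} {μ ν : P2 H} (h : IsCoupling π μ ν) :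
    MemLp (fun z : H × H => z.1) 2 π :=
  (memLp_map_measure_iff aestronglyMeasurable_id measurable_fst.aemeasurable).1
    (h.1.symm ▸ μ.2.2)

theorem IsCoupling.memLp_snd {π : Measure (H × H)} {μ ν : P2 H} (h : IsCoupling π μ ν) :
    MemLp (fun z : H × H => z.2) 2 π :=
  (memLp_map_measure_iff aestronglyMeasurable_id measurable_snd.aemeasurable).1
    (h.2.symm ▸ ν.2.2)

theorem IsCoupling.swap {π : Measure (H × H)} {μ ν : P2 H} (h : IsCoupling π μ ν) :
    IsCoupling (π.map Prod.swap) ν μ := by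
  constructor
  · rw [Measure.map_map measurable_fst measurable_swap]; exact h.2
  · rw [Measure.map_map measurable_snd measurable_swap]; exact h.1

/-- Total convexity, expressed through random variables. -/
theorem TotallyConvex.law_le {φ : P2 H → EReal} (hφ : TotallyConvex φ) {X Y : S → H}
    (hX : MemLp X 2 P) (hY : MemLp Y 2 P) {t : ℝ} (ht : t ∈ Set.Icc (0 : ℝ) 1) :
    φ (law P _ (memLp_interp hX hY t)) ≤
      ((1 - t : ℝ) : EReal) * φ (law P X hX) + (t : EReal) * φ (law P Y hY) := by
  rw [← interp_map hX hY t]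
  exact hφ _ _ _ (isCoupling_map hX hY) t ht

theorem W2_law_le {X Y : S → H} (hX : MemLp X 2 P) (hY : MemLp Y 2 P) :
    W2 (law P X hX) (law P Y hY) ≤ eLpNorm (X - Y) 2 P := by
  have h := hX.1.aemeasurable.prodMk hY.1.aemeasurable
  unfold W2
  rw [eLpNorm_eq_lintegral_rpow_enorm_toReal two_ne_zero ENNReal.ofNat_ne_top]
  simp only [ENNReal.toReal_ofNat]
  gcongr
  refine (iInf₂_le (f := fun π _ => cost π) _ (isCoupling_map hX hY)).trans (le_of_eq ?_)
  unfold cost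
  rw [lintegral_map' (by fun_prop) h]
  simp

theorem IsLsc.le_of_forall {φ : P2 H → EReal} (hφ : IsLsc φ) {μ : P2 H} {c : EReal}
    (h : ∀ ε : ℝ, 0 < ε → ∃ ν, W2 μ ν ≤ ENNReal.ofReal ε ∧ φ ν ≤ c) : φ μ ≤ c := by
  by_contra! hc
  obtain ⟨ε, hε, hν⟩ := hφ _ _ hc
  obtain ⟨r, hr0, hr⟩ := ENNReal.lt_iff_exists_nnreal_btwn.1 hε
  obtain ⟨ν, hW, hle⟩ := h r (NNReal.coe_pos.2 (ENNReal.coe_pos.1 hr0))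
  rw [ENNReal.ofReal_coe_nnreal] at hW
  exact (hν _ (hW.trans_lt hr)).not_ge hle

theorem W2_law_le_ofReal {X Y : S → H} (hX : MemLp X 2 P) (hY : MemLp Y 2 P) {ε : ℝ}
    (h : (eLpNorm (X - Y) 2 P).toReal ≤ ε) :
    W2 (law P X hX) (law P Y hY) ≤ ENNReal.ofReal ε :=
  (W2_law_le hX hY).trans
    ((ENNReal.le_ofReal_iff_toReal_le (hX.sub hY).2.ne (ENNReal.toReal_nonneg.trans h)).2 h)

theorem toReal_eLpNorm_sq {X : S → H} (hX : MemLp X 2 P) :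
    (eLpNorm X 2 P).toReal ^ 2 = ∫ s, ‖X s‖ ^ 2 ∂P := by
  rw [← Lp.norm_toLp X hX, ← real_inner_self_eq_norm_sq, L2.inner_def]
  refine integral_congr_ae ?_
  filter_upwards [hX.coeFn_toLp] with s h
  rw [h, real_inner_self_eq_norm_sq]

theorem integrable_norm_sq {X : S → H} (hX : MemLp X 2 P) :
    Integrable (fun s => ‖X s‖ ^ 2) P :=
  (memLp_two_iff_integrable_sq_norm hX.1).1 hX

/-! ### Realization of couplings -/

/-- A probability measure on a product is the law of `(a, F a u)`, where `a` follows the first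
marginal and `u` is an independent uniform random variable. -/
theorem exists_map_prod_eq {A B : Type*} [MeasurableSpace A] [MeasurableSpace B]
    [StandardBorelSpace B] [Nonempty B] (ρ : Measure (A × B)) [IsProbabilityMeasure ρ] :
    ∃ F : A → unitInterval → B, Measurable (Function.uncurry F) ∧
      (ρ.fst.prod (volume : Measure unitInterval)).map (fun p => (p.1, F p.1 p.2)) = ρ := by
  obtain ⟨F, hF, hκ⟩ := ρ.condKernel.exists_measurable_map_eq_unitInterval
  refine ⟨F, hF, ?_⟩
  have hm : Measurable fun p : A × unitInterval => (p.1, F p.1 p.2) := measurable_fst.prodMk hF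
  conv_rhs => rw [← ρ.disintegrate ρ.condKernel]
  ext s hs
  rw [Measure.map_apply hm hs, Measure.prod_apply (hm hs), Measure.compProd_apply hs]
  refine lintegral_congr fun a => ?_
  rw [← hκ, Measure.map_apply hF.of_uncurry_left (measurable_prodMk_left hs)]
  rfl

/-- The gluing lemma: a coupling of the law of `T` with another measure extends to the space on
which `T` is defined. -/
theorem exists_glue {A B : Type*} [MeasurableSpace A] [MeasurableSpace B]
    [StandardBorelSpace B] [Nonempty B] {T : S → A} (hT : Measurable T) (ρ : Measure (A × B))
    [IsProbabilityMeasure ρ] (h : ρ.map Prod.fst = P.map T) :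
    ∃ G : S × unitInterval → B, Measurable G ∧
      (P.prod (volume : Measure unitInterval)).map (fun p => (T p.1, G p)) = ρ := by
  obtain ⟨F, hF, hFρ⟩ := exists_map_prod_eq ρ
  have hG : Measurable fun p : S × unitInterval => F (T p.1) p.2 :=
    hF.comp ((hT.comp measurable_fst).prodMk measurable_snd)
  refine ⟨_, hG, ?_⟩
  rw [← hFρ, Measure.fst, h]
  have : (P.map T).prod (volume : Measure unitInterval)
      = (P.prod (volume : Measure unitInterval)).map (Prod.map T id) := by
    rw [← Measure.map_prod_map _ _ hT measurable_id, Measure.map_id]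
  have hF' : Measurable fun p : A × unitInterval => (p.1, F p.1 p.2) := measurable_fst.prodMk hF
  rw [this, Measure.map_map hF' (hT.prodMap measurable_id)]
  rfl

/-! ### Inner products of square-integrable random variables and the maximal covariance -/

theorem integrable_inner {X Y : S → H} (hX : MemLp X 2 P) (hY : MemLp Y 2 P) :
    Integrable (fun s => inner ℝ (X s) (Y s)) P := by
  refine (L2.integrable_inner (𝕜 := ℝ) hX.toLp hY.toLp).congr ?_
  filter_upwards [hX.coeFn_toLp, hY.coeFn_toLp] with s h1 h2
  rw [h1, h2]

theorem integral_inner_eq {X Y : S → H} (hX : MemLp X 2 P) (hY : MemLp Y 2 P) :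
    ∫ s, inner ℝ (X s) (Y s) ∂P = inner ℝ hX.toLp hY.toLp := by
  rw [L2.inner_def]
  refine integral_congr_ae ?_
  filter_upwards [hX.coeFn_toLp, hY.coeFn_toLp] with s h1 h2
  rw [h1, h2]

theorem abs_integral_inner_le {X Y : S → H} (hX : MemLp X 2 P) (hY : MemLp Y 2 P) :
    |∫ s, inner ℝ (X s) (Y s) ∂P| ≤ (eLpNorm X 2 P).toReal * (eLpNorm Y 2 P).toReal := by
  rw [integral_inner_eq hX hY, ← Lp.norm_toLp X hX, ← Lp.norm_toLp Y hY]
  exact abs_real_inner_le_norm _ _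

theorem IsCoupling.integral_le_MC {π : Measure (H × H)} {μ ν : P2 H} (h : IsCoupling π μ ν) :
    ((∫ z, inner ℝ z.1 z.2 ∂π : ℝ) : EReal) ≤ MC μ ν :=
  le_iSup₂_of_le π h le_rfl

theorem integral_inner_le_MC {X Y : S → H} (hX : MemLp X 2 P) (hY : MemLp Y 2 P) :
    ((∫ s, inner ℝ (X s) (Y s) ∂P : ℝ) : EReal) ≤ MC (law P X hX) (law P Y hY) := by
  refine le_of_eq_of_le ?_ (isCoupling_map hX hY).integral_le_MC
  rw [integral_map (hX.1.aemeasurable.prodMk hY.1.aemeasurable) (by fun_prop)]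

theorem exists_isCoupling (μ ν : P2 H) : ∃ π, IsCoupling π μ ν := by
  have := μ.2.1
  have := ν.2.1
  exact ⟨μ.1.prod ν.1, by simp [IsCoupling]⟩

theorem IsCoupling.eLpNorm_fst {π : Measure (H × H)} {μ ν : P2 H} (h : IsCoupling π μ ν) :
    eLpNorm (fun z : H × H => z.1) 2 π = eLpNorm (fun x : H => x) 2 μ.1 := by
  rw [← h.1]; exact (eLpNorm_map_measure aestronglyMeasurable_id measurable_fst.aemeasurable).symm

theorem IsCoupling.eLpNorm_snd {π : Measure (H × H)} {μ ν : P2 H} (h : IsCoupling π μ ν) :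
    eLpNorm (fun z : H × H => z.2) 2 π = eLpNorm (fun x : H => x) 2 ν.1 := by
  rw [← h.2]; exact (eLpNorm_map_measure aestronglyMeasurable_id measurable_snd.aemeasurable).symm

/-- The product coupling excludes `⊥`; Cauchy-Schwarz bounds every coupling by the second moments of
the marginals alone, which excludes `⊤`. -/
theorem exists_MC_eq_coe (μ ν : P2 H) : ∃ r : ℝ, MC μ ν = r := by
  obtain ⟨π, hπ⟩ := exists_isCoupling μ ν
  have hbot : MC μ ν ≠ ⊥ := fun h => by
    have := hπ.integral_le_MC
    rw [h, le_bot_iff] at this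
    exact EReal.coe_ne_bot _ this
  have htop : MC μ ν ≠ ⊤ := by
    refine ne_top_of_le_ne_top (EReal.coe_ne_top
      ((eLpNorm (fun x : H => x) 2 μ.1).toReal * (eLpNorm (fun x : H => x) 2 ν.1).toReal)) ?_
    refine iSup₂_le fun π' h => EReal.coe_le_coe_iff.2 ?_
    have := h.isProbabilityMeasure
    refine (le_abs_self _).trans ((abs_integral_inner_le h.memLp_fst h.memLp_snd).trans ?_)
    rw [h.eLpNorm_fst, h.eLpNorm_snd]
  lift MC μ ν to ℝ using ⟨htop, hbot⟩ with r
  exact ⟨r, rfl⟩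

end Basic

section LionsLift

variable {H : Type*} [NormedAddCommGroup H] [InnerProductSpace ℝ H] [CompleteSpace H]
  [SecondCountableTopology H] [MeasurableSpace H] [BorelSpace H]

/-! ### The Lions lift -/

theorem lionsLift_toLp {S : Type*} [MeasurableSpace S] {P : Measure S} [IsProbabilityMeasure P]
    (φ : P2 H → EReal) {X : S → H} (hX : MemLp X 2 P) :
    lionsLift P φ hX.toLp = φ (law P X hX) :=
  congrArg φ (law_congr _ _ hX.coeFn_toLp)

theorem lionsLift_interp {S : Type*} [MeasurableSpace S] {P : Measure S} [IsProbabilityMeasure P]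
    (φ : P2 H → EReal) {X Y : S → H} (hX : MemLp X 2 P) (hY : MemLp Y 2 P) (t : ℝ) :
    lionsLift P φ ((1 - t) • hX.toLp + t • hY.toLp) = φ (law P _ (memLp_interp hX hY t)) := by
  rw [← lionsLift_toLp φ]
  rfl

/-- Valid over every probability space, standard or not; it is applied below over `(H, μ)` itself.
-/
theorem TotallyConvex.convexFun_lionsLift {S : Type*} [MeasurableSpace S] {P : Measure S}
    [IsProbabilityMeasure P] {φ : P2 H → EReal} (hφ : TotallyConvex φ) :
    ConvexFun (lionsLift P φ) := by
  intro x y t ht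
  have h := hφ.law_le (Lp.memLp x) (Lp.memLp y) ht
  have h2 := lionsLift_interp φ (Lp.memLp x) (Lp.memLp y) t
  rw [Lp.toLp_coeFn, Lp.toLp_coeFn] at h2
  exact h2.le.trans h

/-- A coupling is the image of Lebesgue measure on the unit interval, and composing with a
measure-preserving map from `Ω` to the interval realizes it on `Ω`. -/
theorem totallyConvex_of_convexFun_lionsLift {Ω : Type*} [MeasurableSpace Ω] {P : Measure Ω}
    [IsProbabilityMeasure P] (hP : IsStandardProbabilitySpace P) {φ : P2 H → EReal}
    (hφ : ConvexFun (lionsLift P φ)) : TotallyConvex φ := by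
  intro μ ν π h t ht
  have := h.isProbabilityMeasure
  obtain ⟨f, hf, rfl⟩ := π.exists_measurable_map_eq
  obtain ⟨F, -, hF, -⟩ := hP
  have hmp : MeasurePreserving (f ∘ F) P (volume.map f) := (hf.measurePreserving _).comp hF
  have h1 := h.memLp_fst.comp_measurePreserving hmp
  have h2 := h.memLp_snd.comp_measurePreserving hmp
  have hμ : μ = law P _ h1 := by
    rw [law_comp hmp h.memLp_fst]; exact Subtype.ext h.1.symm
  have hν : ν = law P _ h2 := by
    rw [law_comp hmp h.memLp_snd]; exact Subtype.ext h.2.symm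
  have ht' : h.interp t = law P _ (memLp_interp h1 h2 t) :=
    (law_comp hmp (h.memLp_interpMap t)).symm
  rw [ht', ← lionsLift_interp φ, hμ, hν, ← lionsLift_toLp φ, ← lionsLift_toLp φ]
  exact hφ _ _ t ht

/-! ### Total convexity of MC-conjugates -/

/-- A coupling of `μ` with the law of `T`, realized on an extension of the space of `T`. -/
theorem IsCoupling.exists_glue {S : Type*} [MeasurableSpace S] {P : Measure S}
    [IsProbabilityMeasure P] {T : S → H} (hTm : Measurable T) (hT : MemLp T 2 P) {ρ : P2 H}
    {σ : Measure (H × H)} (h : IsCoupling σ (law P T hT) ρ) :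
    ∃ (G : S × unitInterval → H) (hG : MemLp G 2 (P.prod volume)), Measurable G ∧
      (P.prod (volume : Measure unitInterval)).map (fun p => (T p.1, G p)) = σ ∧
      law _ G hG = ρ := by
  have := h.isProbabilityMeasure
  obtain ⟨G, hG, hGσ⟩ := WassersteinConvexity.exists_glue hTm σ h.1
  have hm : Measurable fun p : S × unitInterval => (T p.1, G p) :=
    (hTm.comp measurable_fst).prodMk hG
  have hlaw : (P.prod (volume : Measure unitInterval)).map G = ρ.1 := by
    rw [← h.2, ← hGσ, Measure.map_map measurable_snd hm]
    rfl
  have hGL : MemLp G 2 (P.prod (volume : Measure unitInterval)) :=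
    (memLp_map_measure_iff aestronglyMeasurable_id hG.aemeasurable).1 (hlaw ▸ ρ.2.2)
  exact ⟨G, hGL, hG, hGσ, Subtype.ext hlaw⟩

theorem MC_comm (μ ν : P2 H) : MC μ ν = MC ν μ := by
  have key : ∀ μ ν : P2 H, MC μ ν ≤ MC ν μ := fun μ ν => iSup₂_le fun π h => by
    refine le_of_eq_of_le ?_ h.swap.integral_le_MC
    rw [integral_map measurable_swap.aemeasurable (by fun_prop)]
    simp [real_inner_comm]
  exact le_antisymm (key _ _) (key _ _)

/-- Gluing a coupling of the interpolant and `ρ` to `π` gives a joint law of `(x, y, z)`. The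
pairing with `z` is then linear in `(x, y)`, and the pairs `(x, z)` and `(y, z)` compete in `MC μ ρ`
and `MC ν ρ`. -/
theorem MC_interp_le {μ ν ρ : P2 H} {π : Measure (H × H)} (h : IsCoupling π μ ν)
    {t : ℝ} (ht : t ∈ Set.Icc (0 : ℝ) 1) {a b : ℝ} (ha : MC μ ρ = a) (hb : MC ν ρ = b) :
    MC (h.interp t) ρ ≤ (((1 - t) * a + t * b : ℝ) : EReal) := by
  refine iSup₂_le fun σ hσ => EReal.coe_le_coe_iff.2 ?_
  have := h.isProbabilityMeasure
  obtain ⟨G, hG, hGm, rfl, rfl⟩ :=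
    IsCoupling.exists_glue (measurable_interpMap t) (h.memLp_interpMap t) hσ
  set Q := π.prod (volume : Measure unitInterval)
  have hfst : MeasurePreserving Prod.fst Q π := measurePreserving_fst
  have h1 := h.memLp_fst.comp_measurePreserving hfst
  have h2 := h.memLp_snd.comp_measurePreserving hfst
  have hμ : μ = law Q _ h1 := by
    rw [law_comp hfst h.memLp_fst]; exact Subtype.ext h.1.symm
  have hν : ν = law Q _ h2 := by
    rw [law_comp hfst h.memLp_snd]; exact Subtype.ext h.2.symm
  have ea : ∫ p, inner ℝ p.1.1 (G p) ∂Q ≤ a := by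
    have := integral_inner_le_MC h1 hG
    rw [← hμ, ha] at this
    exact EReal.coe_le_coe_iff.1 this
  have eb : ∫ p, inner ℝ p.1.2 (G p) ∂Q ≤ b := by
    have := integral_inner_le_MC h2 hG
    rw [← hν, hb] at this
    exact EReal.coe_le_coe_iff.1 this
  have hm : Measurable fun p : (H × H) × unitInterval => (interpMap t p.1, G p) :=
    ((measurable_interpMap t).comp measurable_fst).prodMk hGm
  rw [integral_map hm.aemeasurable (by fun_prop)]
  have key : ∫ p, inner ℝ (interpMap t p.1) (G p) ∂Q
      = (1 - t) * ∫ p, inner ℝ p.1.1 (G p) ∂Q + t * ∫ p, inner ℝ p.1.2 (G p) ∂Q := by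
    rw [← integral_const_mul, ← integral_const_mul, ← integral_add]
    · simp only [interpMap, inner_add_left, real_inner_smul_left]
    · exact (integrable_inner h1 hG).const_mul _
    · exact (integrable_inner h2 hG).const_mul _
  rw [key]
  exact add_le_add (mul_le_mul_of_nonneg_left ea (by linarith [ht.2]))
    (mul_le_mul_of_nonneg_left eb ht.1)

theorem totallyConvex_of_mcConvex {φ : P2 H → EReal} (hφ : MCConvex φ) :
    TotallyConvex φ := by
  intro μ ν π h t ht
  have hle : ∀ μ' ρ, MC μ' ρ - mcConj φ ρ ≤ φ μ' := fun μ' ρ => by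
    conv_rhs => rw [← hφ]
    rw [MC_comm]
    exact le_iSup (fun ρ => MC ρ μ' - mcConj φ ρ) ρ
  have h0 : (0 : EReal) ≤ ((1 - t : ℝ) : EReal) := EReal.coe_nonneg.2 (by linarith [ht.2])
  have h1 : (0 : EReal) ≤ (t : EReal) := EReal.coe_nonneg.2 ht.1
  conv_lhs => rw [← hφ]
  refine iSup_le fun ρ => ?_
  rw [MC_comm]
  obtain ⟨a, ha⟩ := exists_MC_eq_coe μ ρ
  obtain ⟨b, hb⟩ := exists_MC_eq_coe ν ρ
  have hc := MC_interp_le h ht ha hb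
  have hμ := hle μ ρ
  have hν := hle ν ρ
  obtain ⟨c, hc'⟩ := exists_MC_eq_coe (h.interp t) ρ
  rw [hc'] at hc ⊢
  rw [ha] at hμ
  rw [hb] at hν
  have hc := EReal.coe_le_coe_iff.1 hc
  induction hψ : mcConj φ ρ with
  | top => simp
  -- A conjugate equal to `⊥` forces `φ = ⊤` at both ends. The right side is then `⊤` even at `t =
  -- 0` and `t = 1`, where only one of the two terms vanishes.
  | bot =>
    rw [hψ] at hμ hν
    have hμ' : φ μ = ⊤ := top_le_iff.1 (by simpa using hμ)
    have hν' : φ ν = ⊤ := top_le_iff.1 (by simpa using hν)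
    rw [hμ', hν']
    rcases ht.1.eq_or_lt with rfl | ht0
    · simp
    · rw [EReal.coe_mul_top_of_pos ht0, EReal.add_top_of_ne_bot]
      · exact le_top
      · rcases (sub_nonneg.2 ht.2).eq_or_lt with h2 | h2
        · rw [← h2]; simp
        · rw [EReal.coe_mul_top_of_pos h2]; simp
  | coe r =>
    rw [hψ] at hμ hν
    refine le_trans ?_ (add_le_add (mul_le_mul_of_nonneg_left hμ h0)
      (mul_le_mul_of_nonneg_left hν h1))
    norm_cast
    linarith

end LionsLift

section Jensen

variable {H : Type*} [NormedAddCommGroup H] [InnerProductSpace ℝ H] [CompleteSpace H]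
  [SecondCountableTopology H] [MeasurableSpace H] [BorelSpace H]
variable {A : Type*} [MeasurableSpace A] {P : Measure A} [IsProbabilityMeasure P]
variable {U : Type*} [MeasurableSpace U] {τ : Measure U} [IsProbabilityMeasure τ]

/-! ### Jensen's inequality for totally convex functionals -/

theorem norm_integral_sq_le {f : U → H} (hf : MemLp f 2 τ) :
    ‖∫ u, f u ∂τ‖ ^ 2 ≤ ∫ u, ‖f u‖ ^ 2 ∂τ := by
  have hc : ConvexOn ℝ Set.univ fun x : H => ‖x‖ ^ 2 :=
    convexOn_univ_norm.pow (fun _ _ => norm_nonneg _) 2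
  exact hc.map_integral_le (by fun_prop) isClosed_univ (by simp)
    (hf.integrable one_le_two) (integrable_norm_sq hf)

theorem memLp_integral {Y : A × U → H} (hYm : Measurable Y) (hY : MemLp Y 2 (P.prod τ)) :
    MemLp (fun a => ∫ u, Y (a, u) ∂τ) 2 P := by
  have hm : StronglyMeasurable fun a => ∫ u, Y (a, u) ∂τ :=
    hYm.stronglyMeasurable.integral_prod_right'
  have hi := integrable_norm_sq hY
  rw [memLp_two_iff_integrable_sq_norm hm.aestronglyMeasurable]
  refine hi.integral_prod_left.mono' (hm.norm.pow 2).aestronglyMeasurable ?_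
  filter_upwards [hi.prod_right_ae] with a ha
  rw [Real.norm_of_nonneg (by positivity)]
  refine norm_integral_sq_le ((memLp_two_iff_integrable_sq_norm ?_).2 ha)
  exact (hYm.comp measurable_prodMk_left).aestronglyMeasurable

theorem ae_memLp_section {Y : A × U → H} (hYm : Measurable Y) (hY : MemLp Y 2 (P.prod τ)) :
    ∀ᵐ a ∂P, MemLp (fun u => Y (a, u)) 2 τ := by
  filter_upwards [(integrable_norm_sq hY).prod_right_ae] with a ha
  exact (memLp_two_iff_integrable_sq_norm
    (hYm.comp measurable_prodMk_left).aestronglyMeasurable).2 ha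

/-- Averaging two conditionally independent copies of a conditionally centered random variable
halves its variance. -/
theorem integral_norm_sq_average {D : A × U → H} (hDm : Measurable D) (hD : MemLp D 2 (P.prod τ))
    (h0 : ∀ᵐ a ∂P, ∫ u, D (a, u) ∂τ = 0) :
    ∫ p, ‖(1 / 2 : ℝ) • D (p.1, p.2.1) + (1 / 2 : ℝ) • D (p.1, p.2.2)‖ ^ 2 ∂(P.prod (τ.prod τ))
      = (1 / 2) * ∫ p, ‖D p‖ ^ 2 ∂(P.prod τ) := by
  have hp1 : MeasurePreserving (Prod.map id Prod.fst) (P.prod (τ.prod τ)) (P.prod τ) :=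
    (MeasurePreserving.id P).prod measurePreserving_fst
  have hp2 : MeasurePreserving (Prod.map id Prod.snd) (P.prod (τ.prod τ)) (P.prod τ) :=
    (MeasurePreserving.id P).prod measurePreserving_snd
  have h1 := hD.comp_measurePreserving hp1
  have h2 := hD.comp_measurePreserving hp2
  have hsq : StronglyMeasurable fun p => ‖D p‖ ^ 2 := (hDm.norm.pow_const 2).stronglyMeasurable
  have e1 : ∫ p, ‖D (p.1, p.2.1)‖ ^ 2 ∂(P.prod (τ.prod τ)) = ∫ p, ‖D p‖ ^ 2 ∂(P.prod τ) := by
    rw [← hp1.map_eq, integral_map hp1.measurable.aemeasurable hsq.aestronglyMeasurable]; rfl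
  have e2 : ∫ p, ‖D (p.1, p.2.2)‖ ^ 2 ∂(P.prod (τ.prod τ)) = ∫ p, ‖D p‖ ^ 2 ∂(P.prod τ) := by
    rw [← hp2.map_eq, integral_map hp2.measurable.aemeasurable hsq.aestronglyMeasurable]; rfl
  have hi := integrable_inner h1 h2
  -- The cross term vanishes: for fixed `a` and first copy, integrating over the second copy pairs a
  -- constant with the conditional mean `0`.
  have e3 : ∫ p, inner ℝ (D (p.1, p.2.1)) (D (p.1, p.2.2)) ∂(P.prod (τ.prod τ)) = 0 := by
    have := integral_prod _ hi
    refine this.trans (integral_eq_zero_of_ae ?_)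
    filter_upwards [hi.prod_right_ae, h0, ae_memLp_section hDm hD] with a ha h0a hDa
    refine (integral_prod _ ha).trans (integral_eq_zero_of_ae (Filter.Eventually.of_forall ?_))
    intro u
    refine (integral_inner (hDa.integrable one_le_two) (D (a, u))).trans ?_
    rw [h0a, inner_zero_right]; rfl
  have hexp : ∀ x y : H, ‖(1 / 2 : ℝ) • x + (1 / 2 : ℝ) • y‖ ^ 2
      = (1 / 4) * ‖x‖ ^ 2 + (1 / 4) * ‖y‖ ^ 2 + (1 / 2) * inner ℝ x y := fun x y => by
    rw [← smul_add, norm_smul, mul_pow, norm_add_sq_real]; norm_num; ring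
  simp_rw [hexp]
  rw [integral_add, integral_add, integral_const_mul, integral_const_mul, integral_const_mul,
    e1, e2, e3]
  · ring
  · exact (integrable_norm_sq h1).const_mul _
  · exact (integrable_norm_sq h2).const_mul _
  · exact ((integrable_norm_sq h1).const_mul _).add ((integrable_norm_sq h2).const_mul _)
  · exact hi.const_mul _

/-- Each step replaces the auxiliary space by its square and `Y'` by the mean of its two
conditionally independent copies. The conditional mean `V` is kept and the variance around it is
halved. -/
theorem TotallyConvex.exists_small_variance {φ : P2 H → EReal} (hφ : TotallyConvex φ)
    {U : Type} [MeasurableSpace U] {τ : Measure U} [IsProbabilityMeasure τ]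
    {Y : A × U → H} (hYm : Measurable Y) (hY : MemLp Y 2 (P.prod τ)) {V : A → H}
    (hVm : Measurable V) (hV : MemLp V 2 P) (hYV : ∀ᵐ a ∂P, ∫ u, Y (a, u) ∂τ = V a) (n : ℕ) :
    ∃ (U' : Type) (_ : MeasurableSpace U') (τ' : Measure U') (_ : IsProbabilityMeasure τ')
      (Y' : A × U' → H) (hY' : MemLp Y' 2 (P.prod τ')), Measurable Y' ∧
      (∀ᵐ a ∂P, ∫ u, Y' (a, u) ∂τ' = V a) ∧
      ∫ p, ‖Y' p - V p.1‖ ^ 2 ∂(P.prod τ') = (1 / 2) ^ n * ∫ p, ‖Y p - V p.1‖ ^ 2 ∂(P.prod τ) ∧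
      φ (law _ Y' hY') ≤ φ (law _ Y hY) := by
  induction n with
  | zero => exact ⟨U, _, τ, inferInstance, Y, hY, hYm, hYV, by simp, le_rfl⟩
  | succ n ih =>
    obtain ⟨U', _, τ', _, Y', hY', hYm', hYV', hint, hle⟩ := ih
    have hp1 : MeasurePreserving (Prod.map id Prod.fst) (P.prod (τ'.prod τ')) (P.prod τ') :=
      (MeasurePreserving.id P).prod measurePreserving_fst
    have hp2 : MeasurePreserving (Prod.map id Prod.snd) (P.prod (τ'.prod τ')) (P.prod τ') :=
      (MeasurePreserving.id P).prod measurePreserving_snd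
    have h1 := hY'.comp_measurePreserving hp1
    have h2 := hY'.comp_measurePreserving hp2
    have hD : MemLp (fun p => Y' p - V p.1) 2 (P.prod τ') :=
      hY'.sub (hV.comp_measurePreserving measurePreserving_fst)
    have hDm : Measurable fun p : A × U' => Y' p - V p.1 := hYm'.sub (hVm.comp measurable_fst)
    refine ⟨U' × U', inferInstance, τ'.prod τ', inferInstance, _,
      memLp_interp h1 h2 (1 / 2), ?_, ?_, ?_, ?_⟩
    · exact ((hYm'.comp hp1.measurable).const_smul _).add ((hYm'.comp hp2.measurable).const_smul _)
    · filter_upwards [hYV', ae_memLp_section hYm' hY'] with a ha hL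
      have hi := hL.integrable one_le_two
      have i1 : Integrable (fun u : U' × U' => Y' (a, u.1)) (τ'.prod τ') := hi.comp_fst τ'
      have i2 : Integrable (fun u : U' × U' => Y' (a, u.2)) (τ'.prod τ') := hi.comp_snd τ'
      have j1 : Integrable (fun u : U' × U' => (1 - 1 / 2 : ℝ) • Y' (a, u.1)) (τ'.prod τ') :=
        i1.smul _
      have j2 : Integrable (fun u : U' × U' => (1 / 2 : ℝ) • Y' (a, u.2)) (τ'.prod τ') := i2.smul _
      simp only [Function.comp_apply, Prod.map_apply, id]
      rw [integral_add j1 j2, integral_smul, integral_smul,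
        integral_fun_fst (fun u => Y' (a, u)), integral_fun_snd (fun u => Y' (a, u)), ha]
      simp only [probReal_univ, one_smul]
      rw [← add_smul]; norm_num
    · rw [pow_succ', mul_assoc, ← hint, ← integral_norm_sq_average hDm hD]
      · refine integral_congr_ae (Filter.Eventually.of_forall fun p => ?_)
        change ‖(1 - 1 / 2 : ℝ) • Y' (p.1, p.2.1) + (1 / 2 : ℝ) • Y' (p.1, p.2.2) - V p.1‖ ^ 2
          = ‖(1 / 2 : ℝ) • (Y' (p.1, p.2.1) - V p.1)
            + (1 / 2 : ℝ) • (Y' (p.1, p.2.2) - V p.1)‖ ^ 2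
        congr 2
        rw [smul_sub, smul_sub]
        have : V p.1 = (1 / 2 : ℝ) • V p.1 + (1 / 2 : ℝ) • V p.1 := by
          rw [← add_smul]; norm_num
        nth_rewrite 1 [this]
        norm_num
        abel
      · filter_upwards [hYV', ae_memLp_section hYm' hY'] with a ha hL
        rw [integral_sub (hL.integrable one_le_two) (integrable_const _), ha]
        simp
    -- Both copies have the law of `Y'`, so the convexity bound is the mean of a value with itself,
    -- also when that value is infinite.
    · refine (hφ.law_le h1 h2 (by norm_num)).trans (le_trans (le_of_eq ?_) hle)
      rw [law_comp hp1 hY', law_comp hp2 hY']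
      generalize φ (law _ Y' hY') = x
      induction x with
      | bot => rw [EReal.coe_mul_bot_of_pos (by norm_num)]; simp
      | top => rw [EReal.coe_mul_top_of_pos (by norm_num), EReal.coe_mul_top_of_pos (by norm_num)]; simp
      | coe r => norm_cast; ring

/-- Totally convex lower semicontinuous functionals decrease under conditional expectation. -/
theorem TotallyConvex.law_integral_le {φ : P2 H → EReal} (hφ : TotallyConvex φ) (hl : IsLsc φ)
    {U : Type} [MeasurableSpace U] {τ : Measure U} [IsProbabilityMeasure τ]
    {Y : A × U → H} (hYm : Measurable Y) (hY : MemLp Y 2 (P.prod τ)) :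
    φ (law P _ (memLp_integral hYm hY)) ≤ φ (law _ Y hY) := by
  have hVm : Measurable fun a => ∫ u, Y (a, u) ∂τ :=
    hYm.stronglyMeasurable.integral_prod_right'.measurable
  have hV := memLp_integral hYm hY
  set V := fun a => ∫ u, Y (a, u) ∂τ
  refine hl.le_of_forall fun ε hε => ?_
  set C := ∫ p, ‖Y p - V p.1‖ ^ 2 ∂(P.prod τ)
  obtain ⟨n, hn⟩ : ∃ n : ℕ, (1 / 2 : ℝ) ^ n * C < ε ^ 2 := by
    have : Filter.Tendsto (fun n : ℕ => (1 / 2 : ℝ) ^ n * C) Filter.atTop (nhds (0 * C)) :=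
      (tendsto_pow_atTop_nhds_zero_of_lt_one (by norm_num) (by norm_num)).mul_const C
    rw [zero_mul] at this
    exact (this.eventually_lt_const (by positivity)).exists
  obtain ⟨U', _, τ', _, Y', hY', hYm', -, hint, hle⟩ :=
    hφ.exists_small_variance hYm hY hVm hV (Filter.Eventually.of_forall fun _ => rfl) n
  refine ⟨_, ?_, hle⟩
  have hfst : MeasurePreserving Prod.fst (P.prod τ') P := measurePreserving_fst
  have hV' := hV.comp_measurePreserving hfst
  rw [← law_comp hfst hV]
  refine W2_law_le_ofReal hV' hY' (abs_le_of_sq_le_sq' ?_ hε.le).2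
  rw [eLpNorm_sub_comm, toReal_eLpNorm_sq (hY'.sub hV')]
  exact (hint.trans_lt hn).le

end Jensen

section FenchelMoreau

/-! ### The Fenchel-Moreau theorem -/

variable {E : Type*} [NormedAddCommGroup E] [NormedSpace ℝ E] {f : E → EReal}

theorem ConvexFun.convex_epigraph (hf : ConvexFun f) :
    Convex ℝ {p : E × ℝ | f p.1 ≤ (p.2 : EReal)} := by
  rintro ⟨x, a⟩ hx ⟨y, b⟩ hy p q hp hq hpq
  simp only [Set.mem_ofPred_eq] at hx hy ⊢
  obtain rfl : p = 1 - q := by linarith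
  refine (hf x y q ⟨hq, by linarith⟩).trans ?_
  refine (add_le_add (mul_le_mul_of_nonneg_left hx (EReal.coe_nonneg.2 hp))
    (mul_le_mul_of_nonneg_left hy (EReal.coe_nonneg.2 hq))).trans (le_of_eq ?_)
  simp

theorem isClosed_real_epigraph (hf : LowerSemicontinuous f) :
    IsClosed {p : E × ℝ | f p.1 ≤ (p.2 : EReal)} :=
  hf.isClosed_epigraph.preimage
    (continuous_fst.prodMk (continuous_coe_real_ereal.comp continuous_snd))

/-- Separation of a point below the graph from the epigraph. -/
theorem exists_separation (hf : ConvexFun f) (hl : LowerSemicontinuous f) {x : E} {r : ℝ}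
    (hr : (r : EReal) < f x) :
    ∃ (g : StrongDual ℝ E) (b u : ℝ), g x + b * r < u ∧
      ∀ (y : E) (s : ℝ), f y ≤ s → u < g y + b * s := by
  obtain ⟨g, u, h1, h2⟩ := geometric_hahn_banach_point_closed hf.convex_epigraph
    (isClosed_real_epigraph hl) (x := (x, r)) (by simpa using hr)
  have hg : ∀ (y : E) (s : ℝ), g (y, s) = g.comp (ContinuousLinearMap.inl ℝ E ℝ) y + g (0, 1) * s :=
    fun y s => by
    have : (y, s) = (y, (0 : ℝ)) + s • ((0 : E), (1 : ℝ)) := by simp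
    rw [this, map_add, map_smul, smul_eq_mul, mul_comm]
    simp
  refine ⟨g.comp (ContinuousLinearMap.inl ℝ E ℝ), g (0, 1), u, ?_, fun y s hys => ?_⟩
  · rw [← hg]; exact h1
  · rw [← hg]; exact h2 _ hys

theorem exists_affine_of_pos {x : E} {r : ℝ} {g : StrongDual ℝ E} {b u : ℝ} (hb : 0 < b)
    (h1 : g x + b * r < u) (h2 : ∀ (y : E) (s : ℝ), f y ≤ s → u < g y + b * s) :
    ∃ (l : StrongDual ℝ E) (c : ℝ), (∀ y, ((l y + c : ℝ) : EReal) ≤ f y) ∧ r < l x + c := by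
  -- Since `b > 0`, the hyperplane `g y + b s = u` is the graph of `s = (u - g y) / b`.
  refine ⟨-(b⁻¹ • g), b⁻¹ * u, fun y => ?_, ?_⟩
  · refine EReal.le_of_forall_lt_iff_le.1 fun s hs => EReal.coe_le_coe_iff.2 ?_
    have := h2 y s hs.le
    have : b⁻¹ * u ≤ b⁻¹ * (g y + b * s) := by gcongr
    rw [mul_add, inv_mul_cancel_left₀ hb.ne'] at this
    simp only [neg_apply, smul_apply, smul_eq_mul]
    linarith
  · have : b⁻¹ * (g x + b * r) < b⁻¹ * u := by gcongr
    rw [mul_add, inv_mul_cancel_left₀ hb.ne'] at this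
    simp only [neg_apply, smul_apply, smul_eq_mul]
    linarith

/-- A convex lower semicontinuous function is the supremum of its continuous affine minorants. -/
theorem ConvexFun.exists_affine_le (hf : ConvexFun f) (hl : LowerSemicontinuous f)
    (hbot : ∀ x, f x ≠ ⊥) {x : E} {r : ℝ} (hr : (r : EReal) < f x) :
    ∃ (l : StrongDual ℝ E) (c : ℝ), (∀ y, ((l y + c : ℝ) : EReal) ≤ f y) ∧ r < l x + c := by
  by_cases hdom : ∃ y, f y ≠ ⊤
  · obtain ⟨x₁, hx₁⟩ := hdom
    obtain ⟨s₁, hs₁⟩ : ∃ s : ℝ, f x₁ = s := by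
      lift f x₁ to ℝ using ⟨hx₁, hbot x₁⟩ with s
      exact ⟨s, rfl⟩
    -- A first minorant exists because the hyperplane is not vertical above a point of finite value:
    -- comparing the heights `s₁ - 1` and `s₁` over `x₁` gives `b > 0`.
    obtain ⟨l₁, c₁, hl₁, -⟩ : ∃ (l : StrongDual ℝ E) (c : ℝ),
        (∀ y, ((l y + c : ℝ) : EReal) ≤ f y) ∧ s₁ - 1 < l x₁ + c := by
      obtain ⟨g, b, u, h1, h2⟩ := exists_separation hf hl (x := x₁) (r := s₁ - 1)
        (by rw [hs₁]; exact EReal.coe_lt_coe_iff.2 (by linarith))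
      have := h2 x₁ s₁ hs₁.le
      exact exists_affine_of_pos (by nlinarith) h1 h2
    obtain ⟨g, b, u, h1, h2⟩ := exists_separation hf hl hr
    rcases lt_trichotomy b 0 with hb | rfl | hb
    -- The epigraph is unbounded upwards over `x₁`, which rules out a negative slope.
    · exfalso
      have h3 := h2 x₁ (max s₁ ((u - g x₁) / b)) (by rw [hs₁]; exact_mod_cast le_max_left _ _)
      have h4 : b * max s₁ ((u - g x₁) / b) ≤ b * ((u - g x₁) / b) :=
        mul_le_mul_of_nonpos_left (le_max_right _ _) hb.le
      rw [mul_div_cancel₀ _ hb.ne] at h4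
      linarith
    -- Vertical hyperplane: `g - u` is positive on the domain and negative at `x`. Subtracting a
    -- large multiple of it from the first minorant keeps a minorant and lifts the value at `x`
    -- above `r`.
    · simp only [zero_mul, add_zero] at h1 h2
      obtain ⟨n, hn⟩ := exists_nat_gt ((r - (l₁ x + c₁)) / (u - g x))
      rw [div_lt_iff₀ (by linarith)] at hn
      refine ⟨l₁ - (n : ℝ) • g, c₁ + n * u, fun y => ?_, ?_⟩
      · refine EReal.le_of_forall_lt_iff_le.1 fun s hs => EReal.coe_le_coe_iff.2 ?_
        have h3 := h2 y s hs.le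
        have h4 := EReal.coe_le_coe_iff.1 ((hl₁ y).trans hs.le)
        have h5 : (n : ℝ) * u ≤ n * g y := by gcongr
        simp only [sub_apply, smul_apply, smul_eq_mul]
        linarith
      · simp only [sub_apply, smul_apply, smul_eq_mul]
        linarith
    · exact exists_affine_of_pos hb h1 h2
  · push Not at hdom
    exact ⟨0, r + 1, fun y => by rw [hdom]; exact le_top, by simp⟩

end FenchelMoreau

section Biconjugate

variable {H : Type*} [NormedAddCommGroup H] [InnerProductSpace ℝ H] [CompleteSpace H]
  [SecondCountableTopology H] [MeasurableSpace H] [BorelSpace H]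

/-! ### The MC-biconjugate of a totally convex functional -/

theorem IsLsc.lowerSemicontinuous_lionsLift {S : Type*} [MeasurableSpace S] {P : Measure S}
    [IsProbabilityMeasure P] {φ : P2 H → EReal} (hφ : IsLsc φ) :
    LowerSemicontinuous (lionsLift P φ) := by
  intro X y hy
  obtain ⟨ε, hε, h⟩ := hφ _ y hy
  filter_upwards [Metric.eball_mem_nhds X hε] with Y hY
  refine h _ ((W2_law_le _ _).trans_lt ?_)
  rw [← Lp.edist_def, edist_comm]
  exact hY

theorem mcConj_mcConj_le (φ : P2 H → EReal) (μ : P2 H) :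
    mcConj (mcConj φ) μ ≤ φ μ := by
  refine iSup_le fun ν => ?_
  obtain ⟨a, ha⟩ := exists_MC_eq_coe μ ν
  have hle : MC μ ν - φ μ ≤ mcConj φ ν := le_iSup (fun μ => MC μ ν - φ μ) μ
  rw [MC_comm, ha]
  rw [ha] at hle
  induction hφ : φ μ with
  | top => exact le_top
  | bot =>
    rw [hφ, EReal.coe_sub_bot, top_le_iff] at hle
    simp [hle]
  | coe s =>
    rw [hφ] at hle
    refine (EReal.sub_le_sub le_rfl hle).trans ?_
    norm_cast
    linarith

/-- The hypothesis tests only variables on `S`, whereas the conjugate sees every coupling with the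
law of `Z`, hence variables `G` on `S × [0,1]`. Averaging `G` over the extra coordinate preserves
its pairing with `Z` and does not increase `φ`. -/
theorem TotallyConvex.mcConj_law_le {φ : P2 H → EReal} (hφ : TotallyConvex φ) (hl : IsLsc φ)
    (hbot : ∀ μ, φ μ ≠ ⊥) {S : Type*} [MeasurableSpace S] {P : Measure S} [IsProbabilityMeasure P]
    {Z : S → H} (hZm : Measurable Z) (hZ : MemLp Z 2 P) {c : ℝ}
    (hc : ∀ (V : S → H) (hV : MemLp V 2 P),
      ((∫ s, inner ℝ (Z s) (V s) ∂P + c : ℝ) : EReal) ≤ φ (law P V hV)) :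
    mcConj φ (law P Z hZ) ≤ ((-c : ℝ) : EReal) := by
  refine iSup_le fun μ => ?_
  induction hs : φ μ with
  | top => simp
  | bot => exact absurd hs (hbot μ)
  | coe s =>
    rw [EReal.sub_le_iff_le_add (by simp) (by simp), ← EReal.coe_add, MC_comm]
    refine iSup₂_le fun σ hσ => EReal.coe_le_coe_iff.2 ?_
    obtain ⟨G, hG, hGm, rfl, rfl⟩ := IsCoupling.exists_glue hZm hZ hσ
    have hm : Measurable fun p : S × unitInterval => (Z p.1, G p) :=
      (hZm.comp measurable_fst).prodMk hGm
    have h1 := hφ.law_integral_le hl hGm hG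
    have h2 := (hc _ (memLp_integral hGm hG)).trans h1
    rw [hs, EReal.coe_le_coe_iff] at h2
    have hi := integrable_inner (hZ.comp_measurePreserving
      (measurePreserving_fst (ν := (volume : Measure unitInterval)))) hG
    have h3 : ∫ z, inner ℝ z.1 z.2 ∂((P.prod (volume : Measure unitInterval)).map
        fun p => (Z p.1, G p)) = ∫ s, inner ℝ (Z s) (∫ u, G (s, u)) ∂P := by
      rw [integral_map hm.aemeasurable (by fun_prop)]
      refine (integral_prod _ hi).trans (integral_congr_ae ?_)
      filter_upwards [ae_memLp_section hGm hG] with s hs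
      exact integral_inner (hs.integrable one_le_two) (Z s)
    rw [h3]
    linarith

theorem TotallyConvex.mcConvex {φ : P2 H → EReal} (hφ : TotallyConvex φ) (hl : IsLsc φ)
    (hbot : ∀ μ, φ μ ≠ ⊥) : MCConvex φ := by
  funext μ
  refine le_antisymm (mcConj_mcConj_le φ μ) ?_
  by_contra! hlt
  obtain ⟨r, hr1, hr2⟩ := EReal.lt_iff_exists_real_btwn.1 hlt
  have := μ.2.1
  have hid : φ μ = lionsLift μ.1 φ (MemLp.toLp _ μ.2.2) := by
    rw [lionsLift_toLp φ, law_id]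
  rw [hid] at hr2
  obtain ⟨l, c, hle, hlt⟩ := (hφ.convexFun_lionsLift (P := μ.1)).exists_affine_le
    hl.lowerSemicontinuous_lionsLift (fun _ => hbot _) hr2
  -- Riesz representation of the slope; the law of `Z` is the competitor in the biconjugate.
  set Z : Lp H 2 μ.1 := (InnerProductSpace.toDual ℝ (Lp H 2 μ.1)).symm l
  have hZm : Measurable Z := (Lp.stronglyMeasurable Z).measurable
  have hZ := Lp.memLp Z
  have hlV : ∀ (V : H → H) (hV : MemLp V 2 μ.1), l hV.toLp = ∫ x, inner ℝ (Z x) (V x) ∂μ.1 :=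
    fun V hV => by
    rw [integral_inner_eq hZ hV, Lp.toLp_coeFn, InnerProductSpace.toDual_symm_apply]
  have hconj : mcConj φ (law μ.1 Z hZ) ≤ ((-c : ℝ) : EReal) := by
    refine hφ.mcConj_law_le hl hbot hZm hZ fun V hV => ?_
    rw [← hlV V hV, ← lionsLift_toLp φ]
    exact hle _
  have hMC : ((l (MemLp.toLp _ μ.2.2) : ℝ) : EReal) ≤ MC (law μ.1 Z hZ) μ := by
    rw [hlV _ μ.2.2]
    exact (integral_inner_le_MC hZ μ.2.2).trans_eq (congrArg _ (law_id μ))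
  refine hr1.not_ge ?_
  calc (r : EReal) ≤ ((l (MemLp.toLp _ μ.2.2) : ℝ) : EReal) - ((-c : ℝ) : EReal) := by
        norm_cast; linarith
    _ ≤ MC (law μ.1 Z hZ) μ - mcConj φ (law μ.1 Z hZ) := EReal.sub_le_sub hMC hconj
    _ ≤ _ := le_iSup (fun ν => MC ν μ - mcConj φ ν) _

end Biconjugate

section Assignment

/-! ### Duality for the assignment problem -/

variable {ι : Type*} [Fintype ι] [DecidableEq ι] [Nonempty ι]

/-- The best profit `max_j (c i j - w j)` at prices `w`. -/
def profit (c : ι → ι → ℝ) (w : ι → ℝ) (i : ι) : ℝ :=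
  Finset.univ.sup' Finset.univ_nonempty fun j => c i j - w j

theorem le_profit (c : ι → ι → ℝ) (w : ι → ℝ) (i j : ι) : c i j - w j ≤ profit c w i :=
  Finset.le_sup' (fun j => c i j - w j) (Finset.mem_univ j)

theorem profit_le {c : ι → ι → ℝ} {w : ι → ℝ} {i : ι} {a : ℝ} (h : ∀ j, c i j - w j ≤ a) :
    profit c w i ≤ a :=
  Finset.sup'_le _ _ fun j _ => h j

theorem continuous_profit (c : ι → ι → ℝ) (i : ι) : Continuous fun w => profit c w i := by
  unfold profit
  exact Continuous.finset_sup'_apply _ fun j _ => by fun_prop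

/-- The dual objective of the assignment problem. -/
def dualObj (c : ι → ι → ℝ) (w : ι → ℝ) : ℝ := ∑ i, profit c w i + ∑ j, w j

/-- Coercivity modulo constants: the objective controls the spread of the prices. Bound the profit
of `i` by the choice `Equiv.swap m k i`, except that `m` chooses itself; the sum of the prices then
cancels up to `w k - w m`. -/
theorem le_dualObj {c : ι → ι → ℝ} {C : ℝ} (hC : ∀ i j, -C ≤ c i j) (w : ι → ℝ) (k m : ι) :
    w k - w m - Fintype.card ι * C ≤ dualObj c w := by
  have h : ∑ i, (-C - w (Equiv.swap m k i) + if i = m then w k - w m else 0)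
      ≤ ∑ i, profit c w i := by
    refine Finset.sum_le_sum fun i _ => ?_
    split_ifs with hi
    · subst hi
      have := le_profit c w i i
      have := hC i i
      rw [Equiv.swap_apply_left]
      linarith
    · have := le_profit c w i (Equiv.swap m k i)
      have := hC i (Equiv.swap m k i)
      linarith
  rw [Finset.sum_add_distrib, Finset.sum_sub_distrib, Finset.sum_ite_eq' Finset.univ m,
    Equiv.sum_comp (Equiv.swap m k) w] at h
  simp only [Finset.sum_const, Finset.card_univ, nsmul_eq_mul, Finset.mem_univ, if_true] at h
  unfold dualObj
  linarith

theorem dualObj_sub_const (c : ι → ι → ℝ) (w : ι → ℝ) (a : ℝ) :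
    dualObj c (fun j => w j - a) = dualObj c w := by
  have h : ∀ i, profit c (fun j => w j - a) i = profit c w i + a := fun i => by
    refine le_antisymm (profit_le fun j => ?_) ?_
    · have := le_profit c w i j
      linarith
    · rw [← le_sub_iff_add_le]
      refine profit_le fun j => ?_
      have := le_profit c (fun j => w j - a) i j
      linarith
  simp only [dualObj, h, Finset.sum_add_distrib, Finset.sum_sub_distrib]
  ring

theorem exists_dualObj_min (c : ι → ι → ℝ) : ∃ w, ∀ w', dualObj c w ≤ dualObj c w' := by
  obtain ⟨C, hC⟩ : ∃ C : ℝ, ∀ i j, -C ≤ c i j := by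
    obtain ⟨C, hC⟩ := (Set.finite_range fun p : ι × ι => -c p.1 p.2).bddAbove
    exact ⟨C, fun i j => by have := hC ⟨(i, j), rfl⟩; simp only at this; linarith⟩
  have hcont : Continuous (dualObj c) := by
    unfold dualObj
    have := continuous_profit c
    fun_prop
  -- Prices with a zero coordinate and an objective no larger than at `0` lie in the box `[-R, R]`,
  -- so it suffices to minimize there.
  set R := dualObj c 0 + Fintype.card ι * C
  have hR : 0 ≤ R := by
    have k := Classical.arbitrary ι
    have := le_dualObj hC 0 k k
    simp only [sub_self] at this
    linarith
  obtain ⟨w, -, hw⟩ := (isCompact_univ_pi fun _ : ι => isCompact_Icc (a := -R) (b := R)).exists_isMinOn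
    ⟨0, fun _ _ => ⟨by simpa using hR, hR⟩⟩ hcont.continuousOn
  refine ⟨w, fun w' => ?_⟩
  have k := Classical.arbitrary ι
  rcases le_total (dualObj c w') (dualObj c 0) with h | h
  · rw [← dualObj_sub_const c w' (w' k)]
    refine hw fun j _ => ⟨?_, ?_⟩
    · have := le_dualObj hC w' k j
      linarith
    · have := le_dualObj hC w' j k
      linarith
  · exact (hw (show (0 : ι → ℝ) ∈ _ from fun _ _ => ⟨by simpa using hR, hR⟩)).trans h

/-- Optimal prices support an optimal assignment. -/
theorem exists_assignment (c : ι → ι → ℝ) :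
    ∃ (σ : Equiv.Perm ι) (w : ι → ℝ), ∀ i j, c i j - w j ≤ c i (σ i) - w (σ i) := by
  obtain ⟨w, hw⟩ := exists_dualObj_min c
  -- The choices attaining the best profit; a perfect matching in this graph, found by Hall's
  -- theorem, is the required permutation.
  set t : ι → Finset ι := fun i => Finset.univ.filter fun j => profit c w i ≤ c i j - w j
  by_cases hall : ∀ s : Finset ι, s.card ≤ (s.biUnion t).card
  · obtain ⟨f, hf, hft⟩ := (Finset.all_card_le_biUnion_card_iff_exists_injective t).1 hall
    refine ⟨Equiv.ofBijective f (Finite.injective_iff_bijective.1 hf), w, fun i j => ?_⟩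
    have h := hft i
    simp only [t, Finset.mem_filter, Finset.mem_univ, true_and] at h
    exact (le_profit c w i j).trans h
  · exfalso
    push Not at hall
    obtain ⟨s, hs⟩ := hall
    set N := s.biUnion t
    obtain ⟨ε, hε, hε0⟩ : ∃ ε : ℝ, (∀ i j, j ∉ t i → ε ≤ profit c w i - (c i j - w j)) ∧ 0 < ε := by
      have : ∀ᶠ ε in nhdsWithin (0 : ℝ) (Set.Ioi 0),
          ∀ i j, j ∉ t i → ε ≤ profit c w i - (c i j - w j) := by
        refine Filter.eventually_all.2 fun i => Filter.eventually_all.2 fun j => ?_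
        by_cases hj : j ∈ t i
        · simp [hj]
        · have hpos : 0 < profit c w i - (c i j - w j) := by
            simp only [t, Finset.mem_filter, Finset.mem_univ, true_and, not_le] at hj
            linarith
          filter_upwards [nhdsWithin_le_nhds (Iic_mem_nhds hpos)] with ε h _ using h
      exact (this.and self_mem_nhdsWithin).exists
    -- Raise the prices on the neighbourhood `N` of a Hall violator `s` by an `ε` below every gap to
    -- a non-optimal choice. Profits on `s` drop by at least `ε` and no others rise, so the
    -- objective falls by at least `(|s| - |N|) ε`, against minimality.
    have h := hw fun j => w j + if j ∈ N then ε else 0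
    have hle : ∑ i, profit c (fun j => w j + if j ∈ N then ε else 0) i
        ≤ ∑ i, (profit c w i - if i ∈ s then ε else 0) := by
      refine Finset.sum_le_sum fun i _ => profit_le fun j => ?_
      have h1 := le_profit c w i j
      by_cases hi : i ∈ s
      · by_cases hj : j ∈ N
        · simp only [hi, hj, if_true]; linarith
        · have := hε i j fun hjt => hj (Finset.mem_biUnion.2 ⟨i, hi, hjt⟩)
          simp only [hi, hj, if_true, if_false]; linarith
      · simp only [hi, if_false]
        split_ifs <;> linarith
    rw [Finset.sum_sub_distrib, Finset.sum_ite_mem, Finset.univ_inter, Finset.sum_const,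
      nsmul_eq_mul] at hle
    unfold dualObj at h
    rw [Finset.sum_add_distrib, Finset.sum_ite_mem, Finset.univ_inter, Finset.sum_const,
      nsmul_eq_mul] at h
    have hs' : (N.card : ℝ) < s.card := by exact_mod_cast hs
    nlinarith

end Assignment

section Chord

open Set Filter Topology

/-! ### A local criterion for lying below the chord -/

/-- On either side of `t`, nearby points lie on a segment from `t` to a fixed `s`, where `g` is
below an affine function of the point with value `g t` at `t`. -/
theorem upperSemicontinuousOn_of_local_convex {g : ℝ → ℝ}
    (h1 : ∀ t ∈ Icc (0 : ℝ) 1, ∃ δ > 0, ∀ s ∈ Icc (0 : ℝ) 1, |s - t| ≤ δ → ∀ l ∈ Icc (0 : ℝ) 1,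
      g ((1 - l) * t + l * s) ≤ (1 - l) * g t + l * g s) :
    UpperSemicontinuousOn g (Icc 0 1) := by
  intro t ht y hy
  obtain ⟨δ, hδ, hg⟩ := h1 t ht
  have key : ∀ s ∈ Icc (0 : ℝ) 1, |s - t| ≤ δ → s ≠ t →
      ∀ᶠ r in 𝓝 t, (r - t) / (s - t) ∈ Icc (0 : ℝ) 1 → g r < y := by
    intro s hs hst hne
    have hne' : s - t ≠ 0 := sub_ne_zero.2 hne
    have hc : Tendsto (fun r => (1 - (r - t) / (s - t)) * g t + (r - t) / (s - t) * g s) (𝓝 t)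
        (𝓝 ((1 - (t - t) / (s - t)) * g t + (t - t) / (s - t) * g s)) :=
      Continuous.tendsto (by fun_prop) t
    simp only [sub_self, zero_div, sub_zero, one_mul, zero_mul, add_zero] at hc
    filter_upwards [hc.eventually_lt_const hy] with r hr hl
    refine lt_of_le_of_lt ?_ hr
    have := hg s hs hst _ hl
    have e : (1 - (r - t) / (s - t)) * t + (r - t) / (s - t) * s = r := by field_simp; ring
    rwa [e] at this
  have hright : ∀ᶠ r in 𝓝 t, r ∈ Icc (0 : ℝ) 1 → t < r → g r < y := by
    rcases ht.2.eq_or_lt with rfl | ht1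
    · exact Eventually.of_forall fun r hr h => absurd hr.2 h.not_ge
    · have hs : t < min (t + δ) 1 := lt_min (by linarith) ht1
      have hs1 := min_le_left (t + δ) 1
      filter_upwards [key (min (t + δ) 1) ⟨ht.1.trans hs.le, min_le_right _ _⟩
        (by rw [abs_of_pos (by linarith)]; linarith) hs.ne', Iio_mem_nhds hs] with r h hr _ htr
      refine h ⟨div_nonneg (by linarith) (by linarith), (div_le_one (by linarith)).2 ?_⟩
      have : r < min (t + δ) 1 := hr
      linarith
  have hleft : ∀ᶠ r in 𝓝 t, r ∈ Icc (0 : ℝ) 1 → r < t → g r < y := by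
    rcases ht.1.eq_or_lt with rfl | ht0
    · exact Eventually.of_forall fun r hr h => absurd hr.1 h.not_ge
    · have hs : max (t - δ) 0 < t := max_lt (by linarith) ht0
      have hs1 := le_max_left (t - δ) 0
      filter_upwards [key (max (t - δ) 0) ⟨le_max_right _ _, hs.le.trans ht.2⟩
        (by rw [abs_of_neg (by linarith)]; linarith) hs.ne, Ioi_mem_nhds hs] with r h hr _ htr
      have : max (t - δ) 0 < r := hr
      refine h ⟨div_nonneg_of_nonpos (by linarith) (by linarith), ?_⟩
      rw [div_le_one_of_neg (by linarith)]
      linarith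
  filter_upwards [nhdsWithin_le_nhds hright, nhdsWithin_le_nhds hleft, self_mem_nhdsWithin]
    with r hr hl hmem
  rcases lt_trichotomy t r with h | rfl | h
  · exact hr hmem h
  · exact hy
  · exact hl hmem h

/-- A function that is locally midpoint convex, and convex along short segments starting at each
point, lies below its chord. -/
theorem le_chord_of_local {g : ℝ → ℝ}
    (h1 : ∀ t ∈ Icc (0 : ℝ) 1, ∃ δ > 0, ∀ s ∈ Icc (0 : ℝ) 1, |s - t| ≤ δ → ∀ l ∈ Icc (0 : ℝ) 1,
      g ((1 - l) * t + l * s) ≤ (1 - l) * g t + l * g s)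
    (h2 : ∀ t ∈ Icc (0 : ℝ) 1, ∃ δ > 0, ∀ h, 0 < h → h ≤ δ → t - h ∈ Icc (0 : ℝ) 1 →
      t + h ∈ Icc (0 : ℝ) 1 → g t ≤ (g (t - h) + g (t + h)) / 2) {t : ℝ} (ht : t ∈ Icc (0 : ℝ) 1) :
    g t ≤ (1 - t) * g 0 + t * g 1 := by
  refine le_of_forall_pos_le_add fun ε hε => ?_
  -- Subtracting the chord makes both end values `0`; the parabola keeps them and adds strict
  -- convexity, so `g + q` cannot have an interior maximum.
  set q : ℝ → ℝ := fun t => ε * (t ^ 2 - t) - ((1 - t) * g 0 + t * g 1)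
  have husc : UpperSemicontinuousOn (fun t => g t + q t) (Icc 0 1) :=
    (upperSemicontinuousOn_of_local_convex h1).add
      ((show Continuous q by fun_prop).upperSemicontinuous.upperSemicontinuousOn _)
  obtain ⟨m, hm, hmax⟩ := husc.exists_isMaxOn ⟨0, by simp⟩ isCompact_Icc
  have hmle : g m + q m ≤ 0 := by
    rcases hm.1.eq_or_lt with rfl | hm0
    · simp [q]
    rcases hm.2.eq_or_lt with rfl | hm1
    · simp [q]
    exfalso
    obtain ⟨δ, hδ, hg⟩ := h2 m hm
    set h := min δ (min m (1 - m))
    have hpos : 0 < h := lt_min hδ (lt_min hm0 (by linarith))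
    have hhm : h ≤ m := (min_le_right _ _).trans (min_le_left _ _)
    have hhm' : h ≤ 1 - m := (min_le_right _ _).trans (min_le_right _ _)
    have i1 : m - h ∈ Icc (0 : ℝ) 1 := ⟨by linarith, by linarith⟩
    have i2 : m + h ∈ Icc (0 : ℝ) 1 := ⟨by linarith, by linarith⟩
    have h3 := hg h hpos (min_le_left _ _) i1 i2
    have h4 : g (m - h) + q (m - h) ≤ g m + q m := hmax i1
    have h5 : g (m + h) + q (m + h) ≤ g m + q m := hmax i2
    have h6 : q (m - h) + q (m + h) = 2 * q m + 2 * ε * h ^ 2 := by simp only [q]; ring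
    have : 0 < ε * h ^ 2 := by positivity
    linarith
  have h7 : g t + q t ≤ 0 := le_trans (hmax ht) hmle
  simp only [q] at h7
  nlinarith [ht.1, ht.2]

end Chord

section Uniform

variable {H : Type*} [NormedAddCommGroup H] [InnerProductSpace ℝ H] [CompleteSpace H]
  [SecondCountableTopology H] [MeasurableSpace H] [BorelSpace H]
variable {ι : Type*} [Fintype ι] [Nonempty ι] [MeasurableSpace ι] [DiscreteMeasurableSpace ι]

/-! ### Uniform measures on finitely many points -/

variable (ι) in
/-- The uniform probability measure on a finite type. -/
def unif : Measure ι := (Fintype.card ι : ENNReal)⁻¹ • Measure.count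

instance : IsProbabilityMeasure (unif ι) := by
  constructor
  rw [unif, Measure.smul_apply, Measure.count_univ, smul_eq_mul]
  simp [ENNReal.inv_mul_cancel]

theorem integral_unif (f : ι → ℝ) :
    ∫ i, f i ∂(unif ι) = (Fintype.card ι : ℝ)⁻¹ * ∑ i, f i := by
  rw [unif, integral_smul_measure, integral_count]
  simp

theorem memLp_unif (x : ι → H) : MemLp x 2 (unif ι) := by
  obtain ⟨C, hC⟩ := (Set.finite_range fun i => ‖x i‖).bddAbove
  exact MemLp.of_bound (Measurable.of_discrete).aestronglyMeasurable C
    (Filter.Eventually.of_forall fun i => hC ⟨i, rfl⟩)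

theorem measurePreserving_perm (σ : Equiv.Perm ι) :
    MeasurePreserving σ (unif ι) (unif ι) := by
  refine ⟨Measurable.of_discrete, ?_⟩
  rw [unif, Measure.map_smul]
  congr 1
  ext s hs
  rw [Measure.map_apply Measurable.of_discrete hs, Measure.count_apply hs,
    Measure.count_apply (Measurable.of_discrete hs),
    Set.encard_preimage_of_bijective σ.bijective]

/-- The empirical law of a finite family of points. -/
def empLaw (x : ι → H) : P2 H := law (unif ι) x (memLp_unif x)

theorem empLaw_comp_perm (x : ι → H) (σ : Equiv.Perm ι) : empLaw (fun i => x (σ i)) = empLaw x :=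
  law_comp (measurePreserving_perm σ) (memLp_unif x)

theorem integral_empLaw (x : ι → H) {f : H → ℝ} (hf : Continuous f) :
    ∫ h, f h ∂(empLaw x).1 = (Fintype.card ι : ℝ)⁻¹ * ∑ i, f (x i) := by
  change ∫ h, f h ∂((unif ι).map x) = _
  rw [integral_map Measurable.of_discrete.aemeasurable hf.measurable.aestronglyMeasurable,
    integral_unif]

theorem integrable_empLaw (x : ι → H) {f : H → ℝ} (hf : Continuous f) :
    Integrable f (empLaw x).1 := by
  change Integrable f ((unif ι).map x)
  rw [integrable_map_measure hf.measurable.aestronglyMeasurable Measurable.of_discrete.aemeasurable]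
  exact Integrable.of_finite

theorem convexOrder_empLaw {x m : ι → H}
    (h : ∀ f : H → ℝ, ConvexOn ℝ Set.univ f → ∑ i, f (x i) ≤ ∑ i, f (m i)) :
    ConvexOrder (empLaw x) (empLaw m) := by
  intro f hf hc _ _
  rw [integral_empLaw x hc, integral_empLaw m hc]
  exact mul_le_mul_of_nonneg_left (h f hf) (by positivity)

theorem IsCoupling.integrable_norm_sub_sq {π : Measure (H × H)} {μ ν : P2 H}
    (h : IsCoupling π μ ν) : Integrable (fun z => ‖z.1 - z.2‖ ^ 2) π := by
  have := h.isProbabilityMeasure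
  exact integrable_norm_sq (h.memLp_fst.sub h.memLp_snd)

theorem cost_eq_ofReal {π : Measure (H × H)} {μ ν : P2 H} (h : IsCoupling π μ ν) :
    cost π = ENNReal.ofReal (∫ z, ‖z.1 - z.2‖ ^ 2 ∂π) := by
  rw [ofReal_integral_eq_lintegral_ofReal h.integrable_norm_sub_sq
    (Filter.Eventually.of_forall fun _ => by positivity)]
  refine lintegral_congr fun z => ?_
  rw [ENNReal.ofReal_pow (norm_nonneg _), ofReal_norm]

/-- Dual potentials certify the optimality of an assignment. -/
theorem isOptimalCoupling_of_potentials {x y : ι → H} {a b : ι → ℝ}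
    (hab : ∀ i j, a i + b j ≤ ‖x i - y j‖ ^ 2) (heq : ∀ i, a i + b i = ‖x i - y i‖ ^ 2) :
    IsOptimalCoupling ((unif ι).map fun i => (x i, y i)) (empLaw x) (empLaw y) := by
  have hcpl : IsCoupling ((unif ι).map fun i => (x i, y i)) (empLaw x) (empLaw y) :=
    isCoupling_map (memLp_unif x) (memLp_unif y)
  refine ⟨hcpl, fun π h => ?_⟩
  rw [cost_eq_ofReal hcpl, cost_eq_ofReal h]
  refine ENNReal.ofReal_le_ofReal ?_
  rw [integral_map Measurable.of_discrete.aemeasurable (by fun_prop), integral_unif]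
  -- The potentials live on indices. These finite minima extend them to continuous functions on `H`,
  -- which can be integrated against any competitor; `A + B` is at most the cost where the first
  -- coordinate is some `x i`.
  set A : H → ℝ := fun p => Finset.univ.inf' Finset.univ_nonempty fun j => ‖p - y j‖ ^ 2 - b j
  set B : H → ℝ := fun q => Finset.univ.inf' Finset.univ_nonempty fun i => ‖x i - q‖ ^ 2 - A (x i)
  have hA : Continuous A := Continuous.finset_inf'_apply _ fun j _ => by fun_prop
  have hB : Continuous B := Continuous.finset_inf'_apply _ fun j _ => by fun_prop
  have hAx : ∀ i, a i ≤ A (x i) := fun i =>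
    Finset.le_inf' _ _ fun j _ => by have := hab i j; linarith
  have hAx' : ∀ i j, A (x i) ≤ ‖x i - y j‖ ^ 2 - b j := fun i j =>
    Finset.inf'_le (fun j => ‖x i - y j‖ ^ 2 - b j) (Finset.mem_univ j)
  have hBy : ∀ j, b j ≤ B (y j) := fun j =>
    Finset.le_inf' _ _ fun i _ => by have := hAx' i j; linarith
  have iA : Integrable (fun z : H × H => A z.1) π := by
    have := integrable_empLaw x hA
    rw [← h.1] at this
    exact this.comp_measurable measurable_fst
  have iB : Integrable (fun z : H × H => B z.2) π := by
    have := integrable_empLaw y hB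
    rw [← h.2] at this
    exact this.comp_measurable measurable_snd
  have eA : ∫ z, A z.1 ∂π = (Fintype.card ι : ℝ)⁻¹ * ∑ i, A (x i) := by
    rw [← integral_empLaw x hA, ← h.1, integral_map measurable_fst.aemeasurable
      hA.measurable.aestronglyMeasurable]
  have eB : ∫ z, B z.2 ∂π = (Fintype.card ι : ℝ)⁻¹ * ∑ i, B (y i) := by
    rw [← integral_empLaw y hB, ← h.2, integral_map measurable_snd.aemeasurable
      hB.measurable.aestronglyMeasurable]
  have hx : ∀ᵐ z ∂π, z.1 ∈ Set.range x := by
    have hm : MeasurableSet (Set.range x) := (Set.finite_range x).measurableSet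
    have : ∀ᵐ p ∂(π.map Prod.fst), p ∈ Set.range x := by
      rw [h.1]
      exact (ae_map_iff Measurable.of_discrete.aemeasurable hm).2
        (Filter.Eventually.of_forall fun i => ⟨i, rfl⟩)
    exact (ae_map_iff measurable_fst.aemeasurable hm).1 this
  calc (Fintype.card ι : ℝ)⁻¹ * ∑ i, ‖x i - y i‖ ^ 2
      ≤ (Fintype.card ι : ℝ)⁻¹ * ∑ i, (A (x i) + B (y i)) := by
        gcongr with i
        rw [← heq i]
        exact add_le_add (hAx i) (hBy i)
    _ = ∫ z, (A z.1 + B z.2) ∂π := by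
        rw [integral_add iA iB, eA, eB, Finset.sum_add_distrib, mul_add]
    _ ≤ ∫ z, ‖z.1 - z.2‖ ^ 2 ∂π := by
        refine integral_mono_ae (iA.add iB) h.integrable_norm_sub_sq ?_
        filter_upwards [hx] with z hz
        obtain ⟨i, hi⟩ := hz
        have : B z.2 ≤ ‖x i - z.2‖ ^ 2 - A (x i) :=
          Finset.inf'_le (fun i => ‖x i - z.2‖ ^ 2 - A (x i)) (Finset.mem_univ i)
        simp only [← hi]
        linarith

theorem DisplacementConvex.empLaw_le {φ : P2 H → EReal} (hφ : DisplacementConvex φ) {x y : ι → H}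
    {a b : ι → ℝ} (hab : ∀ i j, a i + b j ≤ ‖x i - y j‖ ^ 2)
    (heq : ∀ i, a i + b i = ‖x i - y i‖ ^ 2) {t : ℝ} (ht : t ∈ Set.Icc (0 : ℝ) 1) :
    φ (empLaw fun i => (1 - t) • x i + t • y i) ≤
      ((1 - t : ℝ) : EReal) * φ (empLaw x) + (t : EReal) * φ (empLaw y) := by
  have h := hφ _ _ _ (isOptimalCoupling_of_potentials hab heq) t ht
  exact (congrArg φ (interp_map (memLp_unif x) (memLp_unif y) t).symm).le.trans h

theorem exists_separation_radius (x : ι → H) :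
    ∃ D : ℝ, (∀ i j, x i ≠ x j → D ≤ ‖x i - x j‖) ∧ 0 < D := by
  have : ∀ᶠ D in nhdsWithin (0 : ℝ) (Set.Ioi 0), ∀ i j, x i ≠ x j → D ≤ ‖x i - x j‖ := by
    refine Filter.eventually_all.2 fun i => Filter.eventually_all.2 fun j => ?_
    by_cases hij : x i = x j
    · simp [hij]
    · filter_upwards [nhdsWithin_le_nhds (Iic_mem_nhds (norm_pos_iff.2 (sub_ne_zero.2 hij)))]
        with D h _ using h
  exact (this.and self_mem_nhdsWithin).exists

/-- If a permutation `σ` preserves the fibres of `(x + y) / 2`, then the midpoints of `x i` and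
`y (σ i)` dominate those of `x i` and `y i` in convex order. -/
theorem sum_le_sum_midpoint {x y z : ι → H} {σ : Equiv.Perm ι}
    (hz : ∀ i, z i = (1 / 2 : ℝ) • x i + (1 / 2 : ℝ) • y i) (hσ : ∀ i, z (σ i) = z i)
    {f : H → ℝ} (hf : ConvexOn ℝ Set.univ f) :
    ∑ i, f (z i) ≤ ∑ i, f ((1 / 2 : ℝ) • x i + (1 / 2 : ℝ) • y (σ i)) := by
  set m : ι → H := fun i => (1 / 2 : ℝ) • x i + (1 / 2 : ℝ) • y (σ i)
  set K := orderOf σ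
  have hK : 0 < K := orderOf_pos σ
  have hK' : (0 : ℝ) < K := by exact_mod_cast hK
  have hpow : ∀ (k : ℕ) i, z ((σ ^ k) i) = z i := fun k => by
    induction k with
    | zero => simp
    | succ k ih => intro i; rw [pow_succ', Equiv.Perm.mul_apply, hσ, ih]
  -- Over a full period of `σ`, the shift in `y` only permutes the summands, so `m` and `z` have the
  -- same mean along an orbit, and `z` is constant there.
  have hbary : ∀ i, ∑ k ∈ Finset.range K, m ((σ ^ k) i) = (K : ℝ) • z i := fun i => by
    have hshift : ∑ k ∈ Finset.range K, y ((σ ^ (k + 1)) i)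
        = ∑ k ∈ Finset.range K, y ((σ ^ k) i) := by
      have h1 := Finset.sum_range_succ (fun k => y ((σ ^ k) i)) K
      rw [Finset.sum_range_succ', show (σ ^ K) = σ ^ 0 by rw [pow_orderOf_eq_one, pow_zero]] at h1
      exact add_right_cancel h1
    calc ∑ k ∈ Finset.range K, m ((σ ^ k) i)
        = ∑ k ∈ Finset.range K, z ((σ ^ k) i) := by
          simp only [m, hz, Finset.sum_add_distrib, ← Finset.smul_sum]
          congr 2
          rw [← hshift]
          refine Finset.sum_congr rfl fun k _ => ?_
          rw [pow_succ', Equiv.Perm.mul_apply]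
      _ = (K : ℝ) • z i := by
          simp only [hpow, Finset.sum_const, Finset.card_range, Nat.cast_smul_eq_nsmul]
  have hjensen : ∀ i, f (z i) ≤ ∑ k ∈ Finset.range K, (K : ℝ)⁻¹ * f (m ((σ ^ k) i)) := fun i => by
    have h := hf.map_sum_le (t := Finset.range K) (w := fun _ => (K : ℝ)⁻¹)
      (p := fun k => m ((σ ^ k) i)) (fun _ _ => by positivity)
      (by simp [hK'.ne']) (fun _ _ => Set.mem_univ _)
    rwa [← Finset.smul_sum, hbary, inv_smul_smul₀ hK'.ne'] at h
  calc ∑ i, f (z i) ≤ ∑ i, ∑ k ∈ Finset.range K, (K : ℝ)⁻¹ * f (m ((σ ^ k) i)) :=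
        Finset.sum_le_sum fun i _ => hjensen i
    _ = ∑ k ∈ Finset.range K, (K : ℝ)⁻¹ * ∑ i, f (m i) := by
        rw [Finset.sum_comm]
        refine Finset.sum_congr rfl fun k _ => ?_
        rw [← Finset.mul_sum, Equiv.sum_comp (σ ^ k) fun i => f (m i)]
    _ = ∑ i, f (m i) := by
        rw [Finset.sum_const, Finset.card_range, nsmul_eq_mul, mul_inv_cancel_left₀ hK'.ne']

end Uniform

section DiscreteConvexity

variable {H : Type*} [NormedAddCommGroup H] [InnerProductSpace ℝ H] [CompleteSpace H]
  [SecondCountableTopology H] [MeasurableSpace H] [BorelSpace H]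
variable {ι : Type*} [Fintype ι] [Nonempty ι] [MeasurableSpace ι] [DiscreteMeasurableSpace ι]

/-! ### Convexity along couplings of empirical laws -/

/-- The linear interpolation of two families of points. -/
def path (p q : ι → H) (t : ℝ) (i : ι) : H := (1 - t) • p i + t • q i

theorem path_interp (p q : ι → H) (s t l : ℝ) :
    (fun i => (1 - l) • path p q s i + l • path p q t i) = path p q ((1 - l) * s + l * t) := by
  funext i
  simp only [path, smul_add, smul_smul]
  module

theorem path_sub (p q : ι → H) (s t : ℝ) (i : ι) :
    path p q s i - path p q t i = (s - t) • (q i - p i) := by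
  simp only [path]
  module

/-- Short straight segments starting at a finitely supported measure are optimal. -/
theorem DisplacementConvex.path_le {φ : P2 H → EReal} (hφ : DisplacementConvex φ) (p q : ι → H)
    (t : ℝ) : ∃ δ > 0, ∀ s, |s - t| ≤ δ → ∀ l ∈ Set.Icc (0 : ℝ) 1,
      φ (empLaw (path p q ((1 - l) * t + l * s))) ≤
        ((1 - l : ℝ) : EReal) * φ (empLaw (path p q t))
          + (l : EReal) * φ (empLaw (path p q s)) := by
  obtain ⟨D, hD, hD0⟩ := exists_separation_radius (path p q t)
  set B := ∑ i, ‖q i - p i‖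
  have hB : 0 ≤ B := Finset.sum_nonneg fun _ _ => norm_nonneg _
  -- No particle moves further than `D / 2`, half the least distance between distinct positions at
  -- time `t`. Hence no starting position is closer to an endpoint than its own, and the zero
  -- potential at time `t` certifies optimality. The `+ 1` avoids dividing by zero.
  refine ⟨D / (2 * (B + 1)), by positivity, fun s hs l hl => ?_⟩
  rw [← path_interp]
  refine hφ.empLaw_le (a := fun _ => 0) (b := fun j => ‖path p q t j - path p q s j‖ ^ 2)
    (fun i j => ?_) (fun i => by simp) hl
  rw [zero_add]
  by_cases hij : path p q t i = path p q t j
  · rw [hij]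
  · have h1 : ‖path p q t j - path p q s j‖ ≤ D / (2 * (B + 1)) * B := by
      rw [norm_sub_rev, path_sub, norm_smul, Real.norm_eq_abs]
      gcongr
      exact Finset.single_le_sum (f := fun i => ‖q i - p i‖) (fun _ _ => norm_nonneg _)
        (Finset.mem_univ j)
    have h2 : D / (2 * (B + 1)) * B ≤ D / 2 := by
      rw [div_mul_eq_mul_div, div_le_div_iff₀ (by positivity) (by positivity)]
      nlinarith
    have h3 := hD i j hij
    have h4 : ‖path p q t i - path p q t j‖
        ≤ ‖path p q t i - path p q s j‖ + ‖path p q t j - path p q s j‖ := by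
      rw [norm_sub_rev (path p q t j)]
      exact norm_sub_le_norm_sub_add_norm_sub _ _ _
    gcongr
    linarith

/-- Midpoint convexity at each time of the interpolation: particles that meet may be exchanged by
the optimal coupling, which only makes the midpoint larger in convex order. -/
theorem DisplacementConvex.path_midpoint_le {φ : P2 H → EReal} (hφ : DisplacementConvex φ)
    (hcx : IncreasingInConvexOrder φ) (p q : ι → H) (t : ℝ) :
    ∃ δ > 0, ∀ h, 0 < h → h ≤ δ → φ (empLaw (path p q t)) ≤
      ((1 - 1 / 2 : ℝ) : EReal) * φ (empLaw (path p q (t - h)))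
        + ((1 / 2 : ℝ) : EReal) * φ (empLaw (path p q (t + h))) := by
  classical
  obtain ⟨D, hD, hD0⟩ := exists_separation_radius (path p q t)
  set B := ∑ i, ‖q i - p i‖
  have hB : 0 ≤ B := Finset.sum_nonneg fun _ _ => norm_nonneg _
  have hleB : ∀ i, ‖q i - p i‖ ≤ B := fun i =>
    Finset.single_le_sum (f := fun i => ‖q i - p i‖) (fun _ _ => norm_nonneg _) (Finset.mem_univ i)
  refine ⟨D / (4 * (B + 1)), by positivity, fun h h0 hδ => ?_⟩
  have hhB : 4 * h * B < D := by
    rw [le_div_iff₀ (by positivity)] at hδ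
    nlinarith
  set x := path p q (t - h)
  set y := path p q (t + h)
  obtain ⟨σ, w, hσ⟩ := exists_assignment fun i j => -‖x i - y j‖ ^ 2
  have hdist : ∀ i, ‖x i - y i‖ ^ 2 ≤ (2 * h) ^ 2 * B * ‖q i - p i‖ := fun i => by
    rw [path_sub, norm_smul, mul_pow, Real.norm_eq_abs, sq_abs, mul_assoc]
    have := hleB i
    have e : (t - h - (t + h)) ^ 2 = (2 * h) ^ 2 := by ring
    rw [e]
    gcongr
    nlinarith [norm_nonneg (q i - p i)]
  -- The optimal assignment costs at most as much as the identity.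
  have htotal : ∑ i, ‖x i - y (σ i)‖ ^ 2 ≤ (2 * h * B) ^ 2 := by
    have h1 : ∑ i, (‖x i - y (σ i)‖ ^ 2 + w (σ i)) ≤ ∑ i, (‖x i - y i‖ ^ 2 + w i) :=
      Finset.sum_le_sum fun i _ => by have := hσ i i; linarith
    rw [Finset.sum_add_distrib, Finset.sum_add_distrib, Equiv.sum_comp σ w] at h1
    have h2 : ∑ i, ‖x i - y i‖ ^ 2 ≤ ∑ i, (2 * h) ^ 2 * B * ‖q i - p i‖ :=
      Finset.sum_le_sum fun i _ => hdist i
    rw [← Finset.mul_sum] at h2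
    linarith [show (2 * h) ^ 2 * B * B = (2 * h * B) ^ 2 by ring]
  -- An exchange of `i` with `σ i` separates their positions at time `t` by at most `h B + 2 h B + h
  -- B = 4 h B < D`, so these positions coincide.
  have hfix : ∀ i, path p q t (σ i) = path p q t i := fun i => by
    by_contra hne
    have h1 : ‖x i - y (σ i)‖ ^ 2 ≤ (2 * h * B) ^ 2 :=
      (Finset.single_le_sum (f := fun i => ‖x i - y (σ i)‖ ^ 2) (fun _ _ => by positivity)
        (Finset.mem_univ i)).trans htotal
    have h2 := abs_le_of_sq_le_sq' h1 (by positivity)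
    have h3 := hD (σ i) i hne
    have h4 : ‖path p q t (σ i) - y (σ i)‖ ≤ h * B := by
      rw [path_sub, norm_smul, Real.norm_eq_abs, show t - (t + h) = -h by ring, abs_neg,
        abs_of_pos h0]
      exact mul_le_mul_of_nonneg_left (hleB _) h0.le
    have h5 : ‖x i - path p q t i‖ ≤ h * B := by
      rw [path_sub, norm_smul, Real.norm_eq_abs, show t - h - t = -h by ring, abs_neg,
        abs_of_pos h0]
      exact mul_le_mul_of_nonneg_left (hleB _) h0.le
    have h6 : ‖path p q t (σ i) - path p q t i‖
        ≤ ‖path p q t (σ i) - y (σ i)‖ + ‖x i - y (σ i)‖ + ‖x i - path p q t i‖ := by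
      rw [norm_sub_rev (x i) (y (σ i))]
      calc _ = ‖(path p q t (σ i) - y (σ i)) + (y (σ i) - x i) + (x i - path p q t i)‖ := by
            congr 1; abel
        _ ≤ _ := norm_add₃_le
    linarith [h2.2]
  have hmid : ∀ i, path p q t i = (1 / 2 : ℝ) • x i + (1 / 2 : ℝ) • y i := fun i => by
    have := congrFun (path_interp p q (t - h) (t + h) (1 / 2)) i
    rw [show (1 - 1 / 2 : ℝ) = 1 / 2 by norm_num,
      show (1 / 2 : ℝ) * (t - h) + 1 / 2 * (t + h) = t by ring] at this
    exact this.symm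
  have hle := hφ.empLaw_le (x := x) (y := fun i => y (σ i))
    (a := fun i => ‖x i - y (σ i)‖ ^ 2 + w (σ i)) (b := fun j => -w (σ j)) (t := 1 / 2)
    (fun i j => by have := hσ i (σ j); linarith) (fun i => by ring)
    (by norm_num)
  rw [empLaw_comp_perm y σ] at hle
  refine le_trans (hcx _ _ (convexOrder_empLaw fun f hf => ?_)) hle
  rw [show (1 - 1 / 2 : ℝ) = 1 / 2 by norm_num]
  exact sum_le_sum_midpoint hmid hfix hf

/-- Total convexity of the domain makes `φ` real-valued along the whole path, so the chord criterion
for real functions applies. -/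
theorem empLaw_interp_le {φ : P2 H → EReal} (hdom : TotallyConvexSet (dom φ))
    (hφ : DisplacementConvex φ) (hcx : IncreasingInConvexOrder φ) {p q : ι → H}
    (hp : empLaw p ∈ dom φ) (hq : empLaw q ∈ dom φ) {t : ℝ} (ht : t ∈ Set.Icc (0 : ℝ) 1) :
    φ (empLaw fun i => (1 - t) • p i + t • q i) ≤
      ((1 - t : ℝ) : EReal) * φ (empLaw p) + (t : EReal) * φ (empLaw q) := by
  have hfin : ∀ s ∈ Set.Icc (0 : ℝ) 1,
      ((φ (empLaw (path p q s))).toReal : EReal) = φ (empLaw (path p q s)) := fun s hs => by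
    have h := hdom _ hp _ hq _ (isCoupling_map (memLp_unif p) (memLp_unif q)) s hs
    have h' : empLaw (path p q s) ∈ dom φ :=
      (congrArg (· ∈ dom φ) (interp_map (memLp_unif p) (memLp_unif q) s)).mp h
    exact EReal.coe_toReal h'.2 h'.1
  have h := le_chord_of_local (g := fun s => (φ (empLaw (path p q s))).toReal)
    (fun t ht => by
      obtain ⟨δ, hδ, h⟩ := hφ.path_le p q t
      refine ⟨δ, hδ, fun s hs hst l hl => EReal.coe_le_coe_iff.1 ?_⟩
      push_cast
      have hmem : (1 - l) * t + l * s ∈ Set.Icc (0 : ℝ) 1 :=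
        (convex_Icc (0 : ℝ) 1) ht hs (sub_nonneg.2 hl.2) hl.1 (by ring)
      rw [hfin _ ht, hfin _ hs, hfin _ hmem]
      exact_mod_cast h s hst l hl)
    (fun t ht => by
      obtain ⟨δ, hδ, h⟩ := hφ.path_midpoint_le hcx p q t
      refine ⟨δ, hδ, fun r hr0 hrδ h1 h2 => ?_⟩
      have := h r hr0 hrδ
      rw [← hfin _ ht, ← hfin _ h1, ← hfin _ h2, ← EReal.coe_mul, ← EReal.coe_mul,
        ← EReal.coe_add, EReal.coe_le_coe_iff] at this
      linarith) ht
  rw [← EReal.coe_le_coe_iff] at h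
  push_cast at h
  rw [hfin _ ht, hfin 0 (by simp), hfin 1 (by simp)] at h
  have e0 : path p q 0 = p := by funext i; simp [path]
  have e1 : path p q 1 = q := by funext i; simp [path]
  rw [e0, e1] at h
  exact_mod_cast h

end DiscreteConvexity

section Subdivision

/-! ### Subdivision of the unit interval -/

/-- The map `(k, u) ↦ (k + u) / (n + 1)`. -/
def subdiv (n : ℕ) (p : Fin (n + 1) × unitInterval) : unitInterval :=
  ⟨((p.1 : ℕ) + (p.2 : ℝ)) / (n + 1), by
    have h1 : ((p.1 : ℕ) : ℝ) + 1 ≤ n + 1 := by exact_mod_cast p.1.2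
    have h2 := p.2.2.1
    have h3 := p.2.2.2
    constructor
    · positivity
    · rw [div_le_one (by positivity)]; linarith⟩

theorem measurable_subdiv (n : ℕ) : Measurable (subdiv n) := by
  unfold subdiv
  refine Measurable.subtype_mk ?_
  refine Measurable.div_const (Measurable.add ?_ (measurable_subtype_coe.comp measurable_snd)) _
  exact (Measurable.of_discrete (f := fun k : Fin (n + 1) => ((k : ℕ) : ℝ))).comp measurable_fst

theorem volume_coe_le (a : ℝ) :
    (volume : Measure unitInterval) {u | (u : ℝ) ≤ a} = ENNReal.ofReal (max 0 (min 1 a)) := by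
  rcases lt_or_ge a 0 with h0 | h0
  · have : {u : unitInterval | (u : ℝ) ≤ a} = ∅ :=
      Set.eq_empty_of_forall_notMem fun u hu => absurd (u.2.1.trans hu) h0.not_ge
    rw [this, measure_empty, max_eq_left ((min_le_right _ _).trans h0.le), ENNReal.ofReal_zero]
  · rcases le_or_gt a 1 with h1 | h1
    · have : {u : unitInterval | (u : ℝ) ≤ a} = Set.Iic ⟨a, h0, h1⟩ := rfl
      rw [this, unitInterval.volume_Iic, min_eq_right h1, max_eq_right h0]
    · have : {u : unitInterval | (u : ℝ) ≤ a} = Set.univ :=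
        Set.eq_univ_of_forall fun u => u.2.2.trans h1.le
      rw [this, measure_univ, min_eq_left h1.le]
      simp

/-- The `k`-th summand is the length of `[k, k + 1] ∩ [0, y]`; this evaluates the distribution
function of `subdiv`. -/
theorem sum_clamp (n : ℕ) {y : ℝ} (hy : 0 ≤ y) :
    ∑ k ∈ Finset.range n, max 0 (min 1 (y - k)) = min (n : ℝ) y := by
  induction n with
  | zero => simp [hy]
  | succ n ih =>
    rw [Finset.sum_range_succ, ih]
    push_cast
    rcases le_total y n with h | h
    · rw [min_eq_right h, min_eq_right (by linarith : y - n ≤ 1),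
        max_eq_left (by linarith : y - n ≤ 0), min_eq_right (by linarith : y ≤ n + 1), add_zero]
    · rw [min_eq_left h]
      rcases le_total y (n + 1) with h' | h'
      · rw [min_eq_right (by linarith : y - n ≤ 1), max_eq_right (by linarith : 0 ≤ y - n),
          min_eq_right h']
        ring
      · rw [min_eq_left (by linarith : 1 ≤ y - n), min_eq_left h', max_eq_right zero_le_one]

theorem measurePreserving_subdiv (n : ℕ) :
    MeasurePreserving (subdiv n) ((unif (Fin (n + 1))).prod volume) volume := by
  refine ⟨measurable_subdiv n, ?_⟩
  have hm := measurable_subdiv n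
  have := Measure.isProbabilityMeasure_map (μ := (unif (Fin (n + 1))).prod
    (volume : Measure unitInterval)) hm.aemeasurable
  refine Measure.ext_of_Iic _ _ fun x => ?_
  rw [Measure.map_apply hm measurableSet_Iic, Measure.prod_apply (hm measurableSet_Iic),
    unitInterval.volume_Iic]
  have hsec : ∀ k : Fin (n + 1), (volume : Measure unitInterval)
      (Prod.mk k ⁻¹' (subdiv n ⁻¹' Set.Iic x))
        = ENNReal.ofReal (max 0 (min 1 ((n + 1) * (x : ℝ) - (k : ℕ)))) := fun k => by
    rw [← volume_coe_le]
    congr 1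
    ext u
    have hn : (0 : ℝ) < n + 1 := by positivity
    simp only [Set.mem_preimage, Set.mem_Iic, Set.mem_ofPred_eq, ← Subtype.coe_le_coe, subdiv]
    rw [div_le_iff₀ hn]
    constructor <;> intro h <;> linarith
  simp_rw [hsec]
  rw [unif, lintegral_smul_measure, lintegral_count, tsum_fintype,
    ← ENNReal.ofReal_sum_of_nonneg (fun _ _ => le_max_left _ _),
    Fin.sum_univ_eq_sum_range (fun k => max 0 (min 1 ((n + 1) * (x : ℝ) - (k : ℝ)))),
    sum_clamp _ (mul_nonneg (by positivity) x.2.1)]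
  have hn : (0 : ℝ) < n + 1 := by positivity
  rw [min_eq_right (by push_cast; nlinarith [x.2.2]), ENNReal.ofReal_mul hn.le, smul_eq_mul,
    ← mul_assoc, Fintype.card_fin]
  have : ENNReal.ofReal (n + 1 : ℝ) = ((n + 1 : ℕ) : ENNReal) := by
    rw [← ENNReal.ofReal_natCast]; push_cast; rfl
  rw [this, ENNReal.inv_mul_cancel (by simp) (by simp), one_mul]

theorem dist_subdiv_le (n : ℕ) (k : Fin (n + 1)) (u v : unitInterval) :
    dist (subdiv n (k, u)) (subdiv n (k, v)) ≤ 1 / (n + 1) := by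
  rw [Subtype.dist_eq, Real.dist_eq]
  simp only [subdiv]
  rw [← sub_div, abs_div, abs_of_pos (by positivity : (0 : ℝ) < n + 1)]
  gcongr
  rw [abs_le]
  constructor <;> linarith [u.2.1, u.2.2, v.2.1, v.2.2]

end Subdivision

section Averages

variable {H : Type*} [NormedAddCommGroup H] [InnerProductSpace ℝ H] [CompleteSpace H]
  [SecondCountableTopology H] [MeasurableSpace H] [BorelSpace H]

/-! ### Averages over the cells of a subdivision -/

/-- The averages of `X` over the cells of the subdivision into `n + 1` intervals. -/
def cellAvg (n : ℕ) (X : unitInterval → H) (k : Fin (n + 1)) : H := ∫ u, X (subdiv n (k, u))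

/-- Jensen's inequality on each section, then integration over `A`. -/
theorem convexOrder_law_integral {A U : Type*} [MeasurableSpace A] [MeasurableSpace U]
    {P : Measure A} [IsProbabilityMeasure P] {τ : Measure U} [IsProbabilityMeasure τ]
    {Y : A × U → H} (hYm : Measurable Y) (hY : MemLp Y 2 (P.prod τ)) :
    ConvexOrder (law P _ (memLp_integral hYm hY)) (law _ Y hY) := by
  intro f hf hc h1 h2
  have hV := memLp_integral hYm hY
  replace h1 := (integrable_map_measure hc.measurable.aestronglyMeasurable hV.1.aemeasurable).1 h1
  replace h2 := (integrable_map_measure hc.measurable.aestronglyMeasurable hY.1.aemeasurable).1 h2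
  change ∫ x, f x ∂(P.map _) ≤ ∫ x, f x ∂((P.prod τ).map Y)
  rw [integral_map hV.1.aemeasurable hc.measurable.aestronglyMeasurable,
    integral_map hY.1.aemeasurable hc.measurable.aestronglyMeasurable]
  have h2' : Integrable (fun p => f (Y p)) (P.prod τ) := h2
  rw [integral_prod _ h2']
  refine integral_mono_ae h1 h2'.integral_prod_left ?_
  filter_upwards [h2'.prod_right_ae, ae_memLp_section hYm hY] with a ha hL
  exact hf.map_integral_le hc.continuousOn isClosed_univ (by simp) (hL.integrable one_le_two) ha

theorem integral_norm_sub_integral_sq_le {U : Type*} [MeasurableSpace U] {τ : Measure U}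
    [IsProbabilityMeasure τ] {f : U → H} (hf : MemLp f 2 τ) (c : H) :
    ∫ u, ‖f u - ∫ v, f v ∂τ‖ ^ 2 ∂τ ≤ ∫ u, ‖f u - c‖ ^ 2 ∂τ := by
  set m := ∫ v, f v ∂τ
  have hi := hf.integrable one_le_two
  have hfm : MemLp (fun u => f u - m) 2 τ := hf.sub (memLp_const m)
  have hexp : ∀ u, ‖f u - c‖ ^ 2
      = ‖f u - m‖ ^ 2 + 2 * inner ℝ (m - c) (f u - m) + ‖m - c‖ ^ 2 := fun u => by
    rw [← sub_add_sub_cancel (f u) m c, norm_add_sq_real, real_inner_comm]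
  have hinner : ∫ u, inner ℝ (m - c) (f u - m) ∂τ = 0 := by
    have hs : Integrable (fun u => f u - m) τ := hi.sub (integrable_const m)
    rw [integral_inner hs, integral_sub hi (integrable_const m)]
    simp [m]
  simp_rw [hexp]
  have i1 := integrable_norm_sq hfm
  have i2 : Integrable (fun u => 2 * inner ℝ (m - c) (f u - m)) τ :=
    ((hi.sub (integrable_const m)).const_inner (m - c)).const_mul 2
  have i3 : Integrable (fun u => ‖f u - m‖ ^ 2 + 2 * inner ℝ (m - c) (f u - m)) τ := i1.add i2
  rw [integral_add i3 (integrable_const _), integral_add i1 i2, integral_const_mul, hinner]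
  simp

theorem memLp_cellAvg (n : ℕ) (X : unitInterval → H) : MemLp (cellAvg n X) 2 (unif (Fin (n + 1))) :=
  memLp_unif _

theorem memLp_comp_subdiv (n : ℕ) {X : unitInterval → H} (hX : MemLp X 2 volume) :
    MemLp (X ∘ subdiv n) 2 ((unif (Fin (n + 1))).prod volume) :=
  hX.comp_measurePreserving (measurePreserving_subdiv n)

theorem convexOrder_cellAvg (n : ℕ) {X : unitInterval → H} (hXm : Measurable X)
    (hX : MemLp X 2 volume) : ConvexOrder (empLaw (cellAvg n X)) (law volume X hX) := by
  have h := convexOrder_law_integral (hXm.comp (measurable_subdiv n)) (memLp_comp_subdiv n hX)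
  rw [law_comp (measurePreserving_subdiv n) hX] at h
  exact h

/-- Cell averages converge in `L²`. -/
theorem eventually_cellAvg_le {X : unitInterval → H} (hXm : Measurable X) (hX : MemLp X 2 volume)
    {ε : ℝ} (hε : 0 < ε) : ∀ᶠ n in Filter.atTop,
      (eLpNorm (fun p => X (subdiv n p) - cellAvg n X p.1) 2
        ((unif (Fin (n + 1))).prod volume)).toReal ≤ ε := by
  obtain ⟨g, hgX, hg⟩ := hX.exists_boundedContinuous_eLpNorm_sub_le ENNReal.ofNat_ne_top
    (ε := ENNReal.ofReal (ε / 2)) (by simpa using hε)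
  have hgX' : (eLpNorm (X - ⇑g) 2 volume).toReal ≤ ε / 2 :=
    ENNReal.toReal_le_of_le_ofReal (by positivity) hgX
  obtain ⟨δ, hδ, hgδ⟩ := Metric.uniformContinuous_iff.1
    (CompactSpace.uniformContinuous_of_continuous g.continuous) (ε / 2) (by positivity)
  obtain ⟨n₀, hn₀⟩ := exists_nat_one_div_lt hδ
  filter_upwards [Filter.eventually_ge_atTop n₀] with n hn
  set Q := (unif (Fin (n + 1))).prod (volume : Measure unitInterval)
  have hmp := measurePreserving_subdiv n
  have hXs := memLp_comp_subdiv n hX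
  have hgs := memLp_comp_subdiv n hg
  have havg : MemLp (fun p : Fin (n + 1) × unitInterval => cellAvg n X p.1) 2 Q :=
    (memLp_cellAvg n X).comp_measurePreserving measurePreserving_fst
  have h0 : MemLp (fun p : Fin (n + 1) × unitInterval => g (subdiv n (p.1, 0))) 2 Q :=
    (memLp_unif fun k : Fin (n + 1) => g (subdiv n (k, 0))).comp_measurePreserving
      measurePreserving_fst
  have hXm' := hXm.comp (measurable_subdiv n)
  -- The cell average is the best approximation in `L²` that is constant on cells, so it may be
  -- compared with the values of the continuous `g` at the left ends of the cells.
  have hbest : (eLpNorm (fun p => X (subdiv n p) - cellAvg n X p.1) 2 Q).toReal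
      ≤ (eLpNorm (fun p => X (subdiv n p) - g (subdiv n (p.1, 0))) 2 Q).toReal := by
    refine (abs_le_of_sq_le_sq' ?_ ENNReal.toReal_nonneg).2
    have e1 := toReal_eLpNorm_sq (hXs.sub havg)
    have e2 := toReal_eLpNorm_sq (hXs.sub h0)
    have i1 := integrable_norm_sq (hXs.sub havg)
    have i2 := integrable_norm_sq (hXs.sub h0)
    refine e1.trans_le (le_of_le_of_eq ?_ e2.symm)
    rw [integral_prod _ i1, integral_prod _ i2]
    refine integral_mono_ae i1.integral_prod_left i2.integral_prod_left ?_
    filter_upwards [ae_memLp_section hXm' hXs] with k hk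
    exact integral_norm_sub_integral_sq_le hk (g (subdiv n (k, 0)))
  refine hbest.trans ?_
  have hsplit : (fun p : Fin (n + 1) × unitInterval => X (subdiv n p) - g (subdiv n (p.1, 0)))
      = (X - ⇑g) ∘ subdiv n + fun p => g (subdiv n p) - g (subdiv n (p.1, 0)) := by
    funext p; simp
  have hd : MemLp (fun p : Fin (n + 1) × unitInterval =>
      g (subdiv n p) - g (subdiv n (p.1, 0))) 2 Q := hgs.sub h0
  have hb : (eLpNorm (fun p : Fin (n + 1) × unitInterval =>
      g (subdiv n p) - g (subdiv n (p.1, 0))) 2 Q).toReal ≤ ε / 2 := by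
    refine ENNReal.toReal_le_of_le_ofReal (by positivity) ?_
    refine (eLpNorm_le_of_ae_bound (C := ε / 2) (Filter.Eventually.of_forall fun p => ?_)).trans ?_
    · rw [← dist_eq_norm]
      refine (hgδ ?_).le
      refine (dist_subdiv_le n p.1 p.2 0).trans_lt (lt_of_le_of_lt ?_ hn₀)
      gcongr
    · simp
  have hc : (eLpNorm ((X - ⇑g) ∘ subdiv n) 2 Q).toReal ≤ ε / 2 := by
    rwa [eLpNorm_comp_measurePreserving (hX.sub hg).1 hmp]
  have hXg : MemLp ((X - ⇑g) ∘ subdiv n) 2 Q := memLp_comp_subdiv n (hX.sub hg)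
  rw [hsplit]
  calc _ ≤ (eLpNorm ((X - ⇑g) ∘ subdiv n) 2 Q + eLpNorm (fun p : Fin (n + 1) × unitInterval =>
        g (subdiv n p) - g (subdiv n (p.1, 0))) 2 Q).toReal :=
        ENNReal.toReal_mono (ENNReal.add_ne_top.2 ⟨hXg.2.ne, hd.2.ne⟩)
          (eLpNorm_add_le hXg.1 hd.1 one_le_two)
    _ ≤ ε := by
        rw [ENNReal.toReal_add hXg.2.ne hd.2.ne]
        linarith

theorem W2_cellAvg_le {X : unitInterval → H} (hX : MemLp X 2 volume) {n : ℕ} {ε : ℝ}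
    (h : (eLpNorm (fun p => X (subdiv n p) - cellAvg n X p.1) 2
        ((unif (Fin (n + 1))).prod volume)).toReal ≤ ε) :
    W2 (law volume X hX) (empLaw (cellAvg n X)) ≤ ENNReal.ofReal ε := by
  have hfst : MeasurePreserving Prod.fst ((unif (Fin (n + 1))).prod
    (volume : Measure unitInterval)) (unif (Fin (n + 1))) := measurePreserving_fst
  rw [← law_comp (measurePreserving_subdiv n) hX, empLaw, ← law_comp hfst (memLp_unif _)]
  exact W2_law_le_ofReal _ _ h

/-- Properties (a), (b) and (c) imply total convexity. -/
theorem totallyConvex_of_displacementConvex {φ : P2 H → EReal} (hbot : ∀ μ, φ μ ≠ ⊥)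
    (hl : IsLsc φ) (hdom : TotallyConvexSet (dom φ)) (hφ : DisplacementConvex φ)
    (hcx : IncreasingInConvexOrder φ) : TotallyConvex φ := by
  intro μ ν π h t ht
  have := h.isProbabilityMeasure
  obtain ⟨f, hf, rfl⟩ := π.exists_measurable_map_eq
  have hmp : MeasurePreserving f volume (volume.map f) := hf.measurePreserving _
  have h1 := h.memLp_fst.comp_measurePreserving hmp
  have h2 := h.memLp_snd.comp_measurePreserving hmp
  have hμ : law volume _ h1 = μ := by
    rw [law_comp hmp h.memLp_fst]; exact Subtype.ext h.1
  have hν : law volume _ h2 = ν := by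
    rw [law_comp hmp h.memLp_snd]; exact Subtype.ext h.2
  have ht' : law volume _ (memLp_interp h1 h2 t) = h.interp t :=
    law_comp hmp (h.memLp_interpMap t)
  -- Infinite end values are treated apart: the particle argument needs both ends in the domain.
  by_cases htop : φ μ = ⊤ ∨ φ ν = ⊤
  · rcases ht.1.eq_or_lt with rfl | ht0
    · have : h.interp 0 = μ := by
        rw [← ht', ← hμ]; congr 1; funext s; simp
      rw [this]; simp
    rcases ht.2.eq_or_lt with rfl | ht1
    · have : h.interp 1 = ν := by
        rw [← ht', ← hν]; congr 1; funext s; simp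
      rw [this]; simp
    have hmul : ∀ (r : ℝ) (x : EReal), 0 < r → x ≠ ⊥ → (r : EReal) * x ≠ ⊥ := fun r x hr hx => by
      induction x with
      | bot => exact absurd rfl hx
      | top => rw [EReal.coe_mul_top_of_pos hr]; simp
      | coe s => exact_mod_cast EReal.coe_ne_bot (r * s)
    rcases htop with h' | h'
    · rw [h', EReal.coe_mul_top_of_pos (by linarith : 0 < 1 - t),
        EReal.top_add_of_ne_bot (hmul _ _ ht0 (hbot _))]
      exact le_top
    · rw [h', EReal.coe_mul_top_of_pos ht0,
        EReal.add_top_of_ne_bot (hmul _ _ (by linarith) (hbot _))]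
      exact le_top
  push Not at htop
  have hm1 : Measurable ((fun z : H × H => z.1) ∘ f) := measurable_fst.comp hf
  have hm2 : Measurable ((fun z : H × H => z.2) ∘ f) := measurable_snd.comp hf
  set X := (fun z : H × H => z.1) ∘ f
  set Y := (fun z : H × H => z.2) ∘ f
  rw [← ht', ← hμ, ← hν]
  refine hl.le_of_forall fun ε hε => ?_
  obtain ⟨n, hn⟩ := (eventually_cellAvg_le ((hm1.const_smul (1 - t)).add (hm2.const_smul t))
    (memLp_interp h1 h2 t) hε).exists
  refine ⟨_, W2_cellAvg_le _ hn, ?_⟩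
  -- By (c), discretizing does not increase the end values, which in particular stay finite.
  have hX := hcx _ _ (convexOrder_cellAvg n hm1 h1)
  have hY := hcx _ _ (convexOrder_cellAvg n hm2 h2)
  have hdX : empLaw (cellAvg n X) ∈ dom φ :=
    ⟨hbot _, ne_top_of_le_ne_top (by rw [hμ]; exact htop.1) hX⟩
  have hdY : empLaw (cellAvg n Y) ∈ dom φ :=
    ⟨hbot _, ne_top_of_le_ne_top (by rw [hν]; exact htop.2) hY⟩
  have hle := empLaw_interp_le hdom hφ hcx hdX hdY ht
  -- Averaging over cells is linear, so it commutes with interpolation.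
  have havg : empLaw (cellAvg n fun s => (1 - t) • X s + t • Y s)
      = empLaw fun k => (1 - t) • cellAvg n X k + t • cellAvg n Y k := by
    refine law_congr _ _ ?_
    filter_upwards [ae_memLp_section (hm1.comp (measurable_subdiv n)) (memLp_comp_subdiv n h1),
      ae_memLp_section (hm2.comp (measurable_subdiv n)) (memLp_comp_subdiv n h2)] with k hk1 hk2
    have i1 : Integrable (fun u => X (subdiv n (k, u))) := hk1.integrable one_le_two
    have i2 : Integrable (fun u => Y (subdiv n (k, u))) := hk2.integrable one_le_two
    simp only [cellAvg]
    rw [← integral_smul, ← integral_smul]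
    exact integral_add (i1.smul _) (i2.smul _)
  rw [← havg] at hle
  exact hle.trans (add_le_add
    (mul_le_mul_of_nonneg_left hX (EReal.coe_nonneg.2 (by linarith [ht.2])))
    (mul_le_mul_of_nonneg_left hY (EReal.coe_nonneg.2 ht.1)))

end Averages

section ConvexOrder

variable {H : Type*} [NormedAddCommGroup H] [InnerProductSpace ℝ H] [CompleteSpace H]
  [SecondCountableTopology H] [MeasurableSpace H] [BorelSpace H]

/-! ### The maximal covariance is increasing in convex order -/

/-- The maximum of the affine functions `⟨·, z j⟩ - w j`. -/
def maxAffine {ι : Type*} [Fintype ι] [Nonempty ι] (z : ι → H) (w : ι → ℝ) (x : H) : ℝ :=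
  Finset.univ.sup' Finset.univ_nonempty fun j => inner ℝ x (z j) - w j

section MaxAffine

variable {ι : Type*} [Fintype ι] [Nonempty ι] (z : ι → H) (w : ι → ℝ)

theorem le_maxAffine (x : H) (j : ι) : inner ℝ x (z j) - w j ≤ maxAffine z w x :=
  Finset.le_sup' (fun j => inner ℝ x (z j) - w j) (Finset.mem_univ j)

theorem maxAffine_le {x : H} {a : ℝ} (h : ∀ j, inner ℝ x (z j) - w j ≤ a) : maxAffine z w x ≤ a :=
  Finset.sup'_le _ _ fun j _ => h j

theorem continuous_maxAffine : Continuous (maxAffine z w) :=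
  Continuous.finset_sup'_apply _ fun j _ => by fun_prop

theorem convexOn_maxAffine : ConvexOn ℝ Set.univ (maxAffine z w) := by
  refine ⟨convex_univ, fun x _ y _ a b ha hb hab => maxAffine_le z w fun j => ?_⟩
  have h1 := mul_le_mul_of_nonneg_left (le_maxAffine z w x j) ha
  have h2 := mul_le_mul_of_nonneg_left (le_maxAffine z w y j) hb
  rw [inner_add_left, real_inner_smul_left, real_inner_smul_left, smul_eq_mul, smul_eq_mul]
  obtain rfl : b = 1 - a := by linarith
  linarith

theorem maxAffine_le_add {R : ℝ} (hR : ∀ j, ‖z j‖ ≤ R) (x y : H) :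
    maxAffine z w x ≤ maxAffine z w y + R * ‖x - y‖ := by
  refine maxAffine_le z w fun j => ?_
  have h1 := le_maxAffine z w y j
  have h2 : inner ℝ (x - y) (z j) ≤ R * ‖x - y‖ := by
    rw [mul_comm]
    exact (real_inner_le_norm _ _).trans (mul_le_mul_of_nonneg_left (hR j) (norm_nonneg _))
  rw [inner_sub_left] at h2
  linarith

theorem integrable_maxAffine {R : ℝ} (hR : ∀ j, ‖z j‖ ≤ R) {S : Type*} [MeasurableSpace S]
    {P : Measure S} [IsProbabilityMeasure P] {X : S → H} (hX : MemLp X 2 P) :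
    Integrable (fun s => maxAffine z w (X s)) P := by
  refine Integrable.mono' (g := fun s => |maxAffine z w 0| + R * ‖X s‖)
    ((integrable_const _).add ((hX.integrable one_le_two).norm.const_mul R))
    ((continuous_maxAffine z w).comp_aestronglyMeasurable hX.1)
    (Filter.Eventually.of_forall fun s => ?_)
  have h1 := maxAffine_le_add z w hR (X s) 0
  have h2 := maxAffine_le_add z w hR 0 (X s)
  rw [sub_zero] at h1
  rw [zero_sub, norm_neg] at h2
  rw [Real.norm_eq_abs, abs_le]
  constructor <;> linarith [neg_abs_le (maxAffine z w 0), le_abs_self (maxAffine z w 0)]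

end MaxAffine

theorem integral_inner_le_add {S : Type*} [MeasurableSpace S] {P : Measure S}
    [IsProbabilityMeasure P] {X Y Y' : S → H} (hX : MemLp X 2 P) (hY : MemLp Y 2 P)
    (hY' : MemLp Y' 2 P) {a ε : ℝ} (ha : (eLpNorm X 2 P).toReal ≤ a)
    (hε : (eLpNorm (Y - Y') 2 P).toReal ≤ ε) :
    ∫ s, inner ℝ (X s) (Y s) ∂P ≤ ∫ s, inner ℝ (X s) (Y' s) ∂P + a * ε := by
  have h := (le_abs_self _).trans (abs_integral_inner_le hX (hY.sub hY'))
  have h' : (eLpNorm X 2 P).toReal * (eLpNorm (Y - Y') 2 P).toReal ≤ a * ε :=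
    mul_le_mul ha hε ENNReal.toReal_nonneg (ENNReal.toReal_nonneg.trans ha)
  simp only [Pi.sub_apply, inner_sub_right] at h
  rw [integral_sub (integrable_inner hX hY) (integrable_inner hX hY')] at h
  linarith

theorem integral_norm_le_toReal_eLpNorm {S : Type*} [MeasurableSpace S] {P : Measure S}
    [IsProbabilityMeasure P] {X : S → H} (hX : MemLp X 2 P) :
    ∫ s, ‖X s‖ ∂P ≤ (eLpNorm X 2 P).toReal := by
  rw [integral_norm_eq_lintegral_enorm hX.1, ← eLpNorm_one_eq_lintegral_enorm]
  exact ENNReal.toReal_mono hX.2.ne (eLpNorm_le_eLpNorm_of_exponent_le one_le_two hX.1)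

theorem integral_inner_prod {U V : Type*} [MeasurableSpace U] [MeasurableSpace V] {τ : Measure U}
    [IsProbabilityMeasure τ] {τ' : Measure V} [IsProbabilityMeasure τ'] {f : U → H} {g : V → H}
    (hf : MemLp f 2 τ) (hg : MemLp g 2 τ') :
    ∫ p, inner ℝ (f p.1) (g p.2) ∂(τ.prod τ') = inner ℝ (∫ u, f u ∂τ) (∫ v, g v ∂τ') := by
  have hi : Integrable (fun p : U × V => (inner ℝ (f p.1) (g p.2) : ℝ)) (τ.prod τ') :=
    integrable_inner (hf.comp_measurePreserving measurePreserving_fst)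
      (hg.comp_measurePreserving measurePreserving_snd)
  rw [integral_prod _ hi]
  simp only [integral_inner (hg.integrable one_le_two)]
  have hc : ∀ u, inner ℝ (f u) (∫ v, g v ∂τ') = inner ℝ (∫ v, g v ∂τ') (f u) := fun u =>
    real_inner_comm _ _
  rw [real_inner_comm]
  simp only [hc]
  exact integral_inner (hf.integrable one_le_two) _

/-- Coupling two random variables on the unit interval by a permutation of the cells of a
subdivision and independently inside the cells. -/
theorem sum_inner_cellAvg_le_MC {n : ℕ} {Y Z g : unitInterval → H} (hYm : Measurable Y)
    (hY : MemLp Y 2 volume) (hZ : MemLp Z 2 volume) (hgm : Measurable g) (hg : MemLp g 2 volume)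
    {b ε m : ℝ} (hb : (eLpNorm Y 2 volume).toReal ≤ b) (hε : (eLpNorm (g - Z) 2 volume).toReal ≤ ε)
    (hm : MC (law volume Y hY) (law volume Z hZ) = m) (σ : Equiv.Perm (Fin (n + 1))) :
    (Fintype.card (Fin (n + 1)) : ℝ)⁻¹ * ∑ i, inner ℝ (cellAvg n Y i) (cellAvg n g (σ i))
      ≤ m + b * ε := by
  set U := unif (Fin (n + 1))
  -- A point `(i, u, v)` places `Y` at `u` in cell `i` and `g`, `Z` at `v` in cell `σ i`. Given `i`
  -- the two are independent, so the pairing integrates to that of the cell averages.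
  set Q := U.prod ((volume : Measure unitInterval).prod (volume : Measure unitInterval))
  have h1 : MeasurePreserving (subdiv n ∘ Prod.map id Prod.fst) Q (volume : Measure unitInterval) :=
    (measurePreserving_subdiv n).comp ((MeasurePreserving.id U).prod measurePreserving_fst)
  have h2 : MeasurePreserving (subdiv n ∘ Prod.map σ Prod.snd) Q (volume : Measure unitInterval) :=
    (measurePreserving_subdiv n).comp ((measurePreserving_perm σ).prod measurePreserving_snd)
  have hY' := hY.comp_measurePreserving h1
  have hg' := hg.comp_measurePreserving h2
  have hZ' := hZ.comp_measurePreserving h2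
  have hle := integral_inner_le_add hY' hg' hZ' (a := b) (ε := ε)
    (by rwa [eLpNorm_comp_measurePreserving hY.1 h1])
    (by
      have := eLpNorm_comp_measurePreserving (hg.sub hZ).1 h2 (p := 2)
      exact (congrArg ENNReal.toReal this).trans_le hε)
  have hMC := integral_inner_le_MC hY' hZ'
  rw [law_comp h1 hY, law_comp h2 hZ, hm, EReal.coe_le_coe_iff] at hMC
  refine le_trans (le_of_eq ?_) (hle.trans (add_le_add_left hMC _))
  have hi := integrable_inner hY' hg'
  rw [integral_prod _ hi, ← integral_unif]
  refine integral_congr_ae ?_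
  have hsg := (measurePreserving_perm σ).quasiMeasurePreserving.ae
    (ae_memLp_section (hgm.comp (measurable_subdiv n)) (memLp_comp_subdiv n hg))
  filter_upwards [ae_memLp_section (hYm.comp (measurable_subdiv n)) (memLp_comp_subdiv n hY), hsg]
    with i hi1 hi2
  exact (integral_inner_prod hi1 hi2).symm

/-- With `f = maxAffine z w` for optimal prices `w` and an optimal assignment `σ` between cell
averages `y` of `Y ∼ ν` and `z` of an approximation of `Z ∼ ρ`, up to small errors `E⟨G, Z⟩ ≤ ∫ f dμ
+ mean w ≤ ∫ f dν + mean w ≤ mean ⟨y i, z (σ i)⟩ ≤ MC ν ρ`. The convex order enters only in the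
second inequality. -/
theorem MC_le_of_convexOrder {μ ν : P2 H} (h : ConvexOrder μ ν) (ρ : P2 H) : MC μ ρ ≤ MC ν ρ := by
  classical
  obtain ⟨m, hm⟩ := exists_MC_eq_coe ν ρ
  rw [hm]
  refine iSup₂_le fun π hπ => EReal.coe_le_coe_iff.2 ?_
  have := ν.2.1
  have := ρ.2.1
  obtain ⟨Y, hYm, hYν⟩ := ν.1.exists_measurable_map_eq
  obtain ⟨Z, hZm, hZρ⟩ := ρ.1.exists_measurable_map_eq
  have hY : MemLp Y 2 volume := (memLp_map_measure_iff aestronglyMeasurable_id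
    hYm.aemeasurable).1 (hYν ▸ ν.2.2)
  have hZ : MemLp Z 2 volume := (memLp_map_measure_iff aestronglyMeasurable_id
    hZm.aemeasurable).1 (hZρ ▸ ρ.2.2)
  obtain rfl : law volume Y hY = ν := Subtype.ext hYν
  obtain rfl : law volume Z hZ = ρ := Subtype.ext hZρ
  obtain ⟨G, hG, hGm, hGπ, rfl⟩ := IsCoupling.exists_glue hZm hZ hπ.swap
  have hπG : ∫ z, inner ℝ z.1 z.2 ∂π
      = ∫ p, inner ℝ (G p) (Z p.1) ∂((volume : Measure unitInterval).prod (volume : Measure unitInterval)) := by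
    have e : ∫ z, inner ℝ z.1 z.2 ∂π = ∫ z, inner ℝ z.2 z.1 ∂(π.map Prod.swap) := by
      rw [integral_map measurable_swap.aemeasurable (by fun_prop)]; rfl
    have hpm : Measurable fun p : unitInterval × unitInterval => (Z p.1, G p) := (hZm.comp measurable_fst).prodMk hGm
    rw [e, ← hGπ, integral_map hpm.aemeasurable (by fun_prop)]
  rw [hπG]
  set a := (eLpNorm G 2 ((volume : Measure unitInterval).prod (volume : Measure unitInterval))).toReal
  set b := (eLpNorm Y 2 (volume : Measure unitInterval)).toReal
  have ha : 0 ≤ a := ENNReal.toReal_nonneg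
  have hb : 0 ≤ b := ENNReal.toReal_nonneg
  -- The error is `2 a ε` for replacing `Z` by `g` and then by `z` against `G`, `ε` for replacing
  -- `Y` by `y` inside the test function, and `b ε` for returning from `g` to `Z` against `Y`.
  suffices hmain : ∀ ε : ℝ, 0 < ε →
      ∫ p, inner ℝ (G p) (Z p.1) ∂((volume : Measure unitInterval).prod (volume : Measure unitInterval))
        ≤ m + (2 * a + b + 1) * ε by
    refine le_of_forall_pos_le_add fun ε hε => ?_
    have := hmain (ε / (2 * a + b + 1)) (by positivity)
    rwa [mul_div_cancel₀ _ (by positivity)] at this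
  intro ε hε
  obtain ⟨g, hgZ, hg⟩ := hZ.exists_boundedContinuous_eLpNorm_sub_le ENNReal.ofNat_ne_top
    (ε := ENNReal.ofReal ε) (by simpa using hε)
  replace hgZ : (eLpNorm (Z - ⇑g) 2 volume).toReal ≤ ε :=
    ENNReal.toReal_le_of_le_ofReal hε.le hgZ
  have hgm : Measurable g := g.continuous.measurable
  set R := ‖g‖
  have hR : 0 ≤ R := norm_nonneg _
  -- The tolerance `ε / (R + 1)` absorbs the Lipschitz constant `R` of the test function, whose
  -- slopes `z j` are bounded by `‖g‖`.
  obtain ⟨n, hnY, hng⟩ := ((eventually_cellAvg_le hYm hY (ε := ε / (R + 1)) (by positivity)).and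
    (eventually_cellAvg_le hgm hg hε)).exists
  set y := cellAvg n Y
  set z := cellAvg n g
  have hz : ∀ j, ‖z j‖ ≤ R := fun j => by
    have := norm_integral_le_of_norm_le_const (μ := (volume : Measure unitInterval)) (C := R)
      (Filter.Eventually.of_forall fun u => g.norm_coe_le_norm (subdiv n (j, u)))
    simpa [z, cellAvg] using this
  obtain ⟨σ, w, hσ⟩ := exists_assignment fun i j => inner ℝ (y i) (z j)
  set N := (Fintype.card (Fin (n + 1)) : ℝ)⁻¹
  set U := unif (Fin (n + 1))
  have hfst : MeasurePreserving Prod.fst (U.prod (volume : Measure unitInterval)) U := measurePreserving_fst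
  have hsub := measurePreserving_subdiv n
  have step1 : ∫ p, inner ℝ (G p) (Z p.1) ∂((volume : Measure unitInterval).prod (volume : Measure unitInterval))
      ≤ ∫ s, maxAffine z w s ∂(law _ G hG).1 + N * ∑ j, w j + 2 * a * ε := by
    have hsnd : MeasurePreserving Prod.fst ((volume : Measure unitInterval).prod
      (volume : Measure unitInterval)) volume := measurePreserving_fst
    have hmp : MeasurePreserving (Prod.map (subdiv n) id)
        ((U.prod (volume : Measure unitInterval)).prod (volume : Measure unitInterval))
        ((volume : Measure unitInterval).prod (volume : Measure unitInterval)) :=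
      hsub.prod (MeasurePreserving.id volume)
    have hfst' : MeasurePreserving Prod.fst
        ((U.prod (volume : Measure unitInterval)).prod (volume : Measure unitInterval))
        (U.prod (volume : Measure unitInterval)) := measurePreserving_fst
    have hg1 := hg.comp_measurePreserving hsnd
    have hG2 := hG.comp_measurePreserving hmp
    have hg2 := hg1.comp_measurePreserving hmp
    have hz2 := ((memLp_unif z).comp_measurePreserving hfst).comp_measurePreserving hfst'
    have hw2 : Integrable (fun q : (Fin (n + 1) × unitInterval) × unitInterval => w q.1.1)
        ((U.prod (volume : Measure unitInterval)).prod (volume : Measure unitInterval)) :=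
      ((Integrable.of_finite (μ := U) (f := w)).comp_fst volume).comp_fst volume
    have hf2 : Integrable (fun q => maxAffine z w (G (Prod.map (subdiv n) id q)))
        ((U.prod (volume : Measure unitInterval)).prod (volume : Measure unitInterval)) :=
      integrable_maxAffine z w hz hG2
    have hc := continuous_maxAffine z w
    have e1 : ∫ p, inner ℝ (G p) (g p.1)
          ∂((volume : Measure unitInterval).prod (volume : Measure unitInterval))
        = ∫ q, inner ℝ (G (Prod.map (subdiv n) id q)) (g (subdiv n q.1))
          ∂((U.prod (volume : Measure unitInterval)).prod (volume : Measure unitInterval)) := by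
      rw [← hmp.map_eq, integral_map hmp.measurable.aemeasurable]
      · rfl
      · exact (hGm.inner (hgm.comp measurable_fst)).aestronglyMeasurable
    have e2 : ∫ q, maxAffine z w (G (Prod.map (subdiv n) id q))
          ∂((U.prod (volume : Measure unitInterval)).prod (volume : Measure unitInterval))
        = ∫ s, maxAffine z w s ∂(law _ G hG).1 := by
      rw [← law_comp hmp hG]
      exact (integral_map hG2.1.aemeasurable hc.measurable.aestronglyMeasurable).symm
    have e3 : ∫ q, w q.1.1
          ∂((U.prod (volume : Measure unitInterval)).prod (volume : Measure unitInterval))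
        = N * ∑ j, w j := by
      rw [integral_fun_fst (fun q : Fin (n + 1) × unitInterval => w q.1), integral_fun_fst w,
        integral_unif]
      simp [N]
    have l1 := integral_inner_le_add hG (hZ.comp_measurePreserving hsnd) hg1 (a := a) (ε := ε)
      le_rfl ((congrArg ENNReal.toReal
        (eLpNorm_comp_measurePreserving (hZ.sub hg).1 hsnd (p := 2))).trans_le hgZ)
    have l2 := integral_inner_le_add hG2 hg2 hz2 (a := a) (ε := ε)
      (congrArg ENNReal.toReal (eLpNorm_comp_measurePreserving hG.1 hmp)).le
      ((congrArg ENNReal.toReal (eLpNorm_comp_measurePreserving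
        ((memLp_comp_subdiv n hg).sub ((memLp_unif z).comp_measurePreserving hfst)).1
        hfst' (p := 2))).trans_le hng)
    have l3 : ∫ q, inner ℝ (G (Prod.map (subdiv n) id q)) (z q.1.1)
          ∂((U.prod (volume : Measure unitInterval)).prod (volume : Measure unitInterval))
        ≤ ∫ q, (maxAffine z w (G (Prod.map (subdiv n) id q)) + w q.1.1)
          ∂((U.prod (volume : Measure unitInterval)).prod (volume : Measure unitInterval)) :=
      integral_mono (integrable_inner hG2 hz2) (hf2.add hw2) fun q => by
        have := le_maxAffine z w (G (Prod.map (subdiv n) id q)) q.1.1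
        simp only
        linarith
    rw [integral_add hf2 hw2] at l3
    change _ ≤ ∫ p, inner ℝ (G p) (g p.1) ∂_ + _ at l1
    change ∫ p, inner ℝ (G p) (Z p.1) ∂_ ≤ _ at l1
    change _ ≤ ∫ q, inner ℝ (G (Prod.map (subdiv n) id q)) (z q.1.1) ∂_ + _ at l2
    change ∫ q, inner ℝ (G (Prod.map (subdiv n) id q)) (g (subdiv n q.1)) ∂_ ≤ _ at l2
    rw [e3] at l3
    linarith
  have step2 : ∫ s, maxAffine z w s ∂(law _ Y hY).1
      ≤ N * ∑ i, inner ℝ (y i) (z (σ i)) - N * ∑ j, w j + ε := by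
    have hYs := memLp_comp_subdiv n hY
    have hys : MemLp (fun p : Fin (n + 1) × unitInterval => y p.1) 2 (U.prod (volume : Measure unitInterval)) :=
      (memLp_unif y).comp_measurePreserving hfst
    have hlaw : law _ Y hY = law _ _ hYs := (law_comp hsub hY).symm
    rw [hlaw]
    change ∫ s, maxAffine z w s ∂((U.prod (volume : Measure unitInterval)).map (Y ∘ subdiv n)) ≤ _
    rw [integral_map hYs.1.aemeasurable (continuous_maxAffine z w).measurable.aestronglyMeasurable]
    have hd := hYs.sub hys
    have i1 := integrable_maxAffine z w hz hys
    have i2 : Integrable (fun p : Fin (n + 1) × unitInterval => R * ‖Y (subdiv n p) - y p.1‖)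
        (U.prod (volume : Measure unitInterval)) := (hd.integrable one_le_two).norm.const_mul R
    -- At `y i` the maximum of the affine functions is attained at `σ i`, so duality loses nothing
    -- here.
    have hfy : ∀ i, maxAffine z w (y i) ≤ inner ℝ (y i) (z (σ i)) - w (σ i) := fun i =>
      maxAffine_le z w fun j => hσ i j
    calc _ ≤ ∫ p, (maxAffine z w (y p.1) + R * ‖Y (subdiv n p) - y p.1‖)
          ∂(U.prod (volume : Measure unitInterval)) :=
          integral_mono (integrable_maxAffine z w hz hYs) (i1.add i2) fun p =>
            maxAffine_le_add z w hz _ _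
      _ = ∫ i, maxAffine z w (y i) ∂U + R * ∫ p, ‖Y (subdiv n p) - y p.1‖
          ∂(U.prod (volume : Measure unitInterval)) := by
          rw [integral_add i1 i2, integral_const_mul,
            integral_fun_fst (fun i => maxAffine z w (y i))]
          simp
      _ ≤ N * ∑ i, (inner ℝ (y i) (z (σ i)) - w (σ i)) + R * (ε / (R + 1)) := by
          rw [integral_unif]
          gcongr with i
          · exact hfy i
          · exact (integral_norm_le_toReal_eLpNorm hd).trans hnY
      _ ≤ _ := by
          rw [Finset.sum_sub_distrib, Equiv.sum_comp σ w, mul_sub]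
          have : R * (ε / (R + 1)) ≤ ε := by
            rw [mul_div_assoc', div_le_iff₀ (by positivity)]
            nlinarith
          linarith
  have step3 : N * ∑ i, inner ℝ (y i) (z (σ i)) ≤ m + b * ε := by
    refine sum_inner_cellAvg_le_MC hYm hY hZ hgm hg le_rfl ?_ hm σ
    rwa [eLpNorm_sub_comm]
  have step4 := h _ (convexOn_maxAffine z w) (continuous_maxAffine z w)
    ((integrable_map_measure (continuous_maxAffine z w).measurable.aestronglyMeasurable
      hG.1.aemeasurable).2 (integrable_maxAffine z w hz hG))
    ((integrable_map_measure (continuous_maxAffine z w).measurable.aestronglyMeasurable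
      hY.1.aemeasurable).2 (integrable_maxAffine z w hz hY))
  linarith

theorem MCConvex.increasingInConvexOrder {φ : P2 H → EReal} (hφ : MCConvex φ) :
    IncreasingInConvexOrder φ := by
  intro μ ν h
  rw [← hφ]
  refine iSup_mono fun ρ => EReal.sub_le_sub ?_ le_rfl
  rw [MC_comm ρ μ, MC_comm ρ ν]
  exact MC_le_of_convexOrder h ρ

theorem TotallyConvex.totallyConvexSet_dom {φ : P2 H → EReal} (hφ : TotallyConvex φ)
    (hbot : ∀ μ, φ μ ≠ ⊥) : TotallyConvexSet (dom φ) := by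
  intro μ hμ ν hν π h t ht
  refine ⟨hbot _, ne_top_of_le_ne_top ?_ (hφ μ ν π h t ht)⟩
  rw [← EReal.coe_toReal hμ.2 hμ.1, ← EReal.coe_toReal hν.2 hν.1]
  exact_mod_cast EReal.coe_ne_top _

end ConvexOrder

end WassersteinConvexity

end

theorem proposition1p9 {H : Type*} [NormedAddCommGroup H] [InnerProductSpace ℝ H]
    [CompleteSpace H] [SecondCountableTopology H] [MeasurableSpace H] [BorelSpace H]
    {Ω : Type*} [MeasurableSpace Ω] (P : Measure Ω) [IsProbabilityMeasure P]
    (hP : WassersteinConvexity.IsStandardProbabilitySpace P)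
    (φ : WassersteinConvexity.P2 H → EReal) (hbot : ∀ μ, φ μ ≠ ⊥)
    (hlsc : WassersteinConvexity.IsLsc φ) :
    List.TFAE [
      WassersteinConvexity.TotallyConvex φ,
      WassersteinConvexity.ConvexFun (WassersteinConvexity.lionsLift P φ),
      WassersteinConvexity.MCConvex φ,
      WassersteinConvexity.TotallyConvexSet (WassersteinConvexity.dom φ) ∧
        WassersteinConvexity.DisplacementConvex φ ∧
        WassersteinConvexity.IncreasingInConvexOrder φ] := by
  tfae_have 1 → 2 := fun h => h.convexFun_lionsLift
  tfae_have 2 → 1 := WassersteinConvexity.totallyConvex_of_convexFun_lionsLift hP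
  tfae_have 1 → 3 := fun h => h.mcConvex hlsc hbot
  tfae_have 3 → 1 := WassersteinConvexity.totallyConvex_of_mcConvex
  tfae_have 1 → 4 := fun h => ⟨h.totallyConvexSet_dom hbot, fun μ ν π hπ t ht => h μ ν π hπ.1 t ht,
    (h.mcConvex hlsc hbot).increasingInConvexOrder⟩
  tfae_have 4 → 1 := fun h =>
    WassersteinConvexity.totallyConvex_of_displacementConvex hbot hlsc h.1 h.2.1 h.2.2
  tfae_finish
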